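/- All rings are commutative with identity. A Serre class of modules over a ring $B$ is a class $\mathcal S$ of $B$-modules containing $0$ such that, for every exact sequence $0\to L\to M\to N\to 0$ of $B$-modules, $M\in\mathcal S$ if and only if $L\in\mathcal S$ and $N\in\mathcal S$. For a class $\mathcal S$ of $B$-modules, a sequence $x_1,\dots,x_r$ in $B$ is a weak $M$-sequence with respect to $\mathcal S$ if for each $i=1,\dots,r$ the module $\big((x_1,\dots,x_{i-1})M:_M x_i\big)/(x_1,\dots,x_{i-1})M$ belongs to $\mathcal S$. If $B$ is Noetherian local, a finitely generated $B$-module $M$ is called $\mathcal S$-Cohen–Macaulay if every system of parameters of $M$ is a weak $M$-sequence with respect to $\mathcal S$ (the zero module is $\mathcal S$-Cohen–Macaulay). Put $\mathcal S\text{-}\operatorname{Supp}_B(M)=\{\mathfrak p\in\operatorname{Supp}_B(M): B/\mathfrak p\notin\mathcal S\}$. **Theorem 3.9.** Let $f:(R,\mathfrak m)\to(A,\mathfrak n)$ be a flat local homomorphism of Noetherian local rings, $\mathcal S$ a Serre class of $A$-modules, and $M$ a finitely generated $R$-module. Let $\mathcal S^c$ be the class of all $R$-modules $N$ such that $N\otimes_R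 A\in\mathcal S$. Then the $A$-module $M\otimes_R A$ is $\mathcal S$-Cohen–Macaulay if and only if the following three conditions hold: 1. $M$ is $\mathcal S^c$-Cohen–Macaulay; 2. the local ring $A_{\mathfrak q}/f^{-1}(\mathfrak q)A_{\mathfrak q}$ is Cohen–Macaulay for every $\mathfrak q\in\mathcal S\text{-}\operatorname{Supp}_A(M\otimes_R A)$; 3. $\operatorname{ht}\big(\mathfrak q/f^{-1}(\mathfrak q)A\big)+\dim(A/\mathfrak q)=\dim\big(A/f^{-1}(\mathfrak q)A\big)$ for every $\mathfrak q\in\mathcal S\text{-}\operatorname{Supp}_A(M\otimes_R A)$. -/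

import Mathlib

open CategoryTheory TensorProduct

universe u

namespace SerreCM

section Sequences

variable {R : Type u} [CommRing R]

/-- The submodule `(x₁, …, xᵣ)M` of `M`. -/
abbrev listSMulTop (xs : List R) (M : Type u) [AddCommGroup M] [Module R M] : Submodule R M :=
  Ideal.ofList xs • (⊤ : Submodule R M)

/-- The submodule `(N :_M x) = {m ∈ M | x m ∈ N}` of `M`. -/
def colonElem {M : Type u} [AddCommGroup M] [Module R M] (N : Submodule R M) (x : R) :
    Submodule R M :=
  N.comap (LinearMap.lsmul R M x)

/-- `x₁, …, xᵣ` is a weak `M`-sequence with respect to a class `S` of `R`-modules: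
for each `i`, the module `((x₁, …, xᵢ₋₁)M :_M xᵢ) / (x₁, …, xᵢ₋₁)M` belongs to `S`. -/
def IsWeakSequence (S : ObjectProperty (ModuleCat.{u} R))
    (M : Type u) [AddCommGroup M] [Module R M] (xs : List R) : Prop :=
  ∀ (i : ℕ) (h : i < xs.length),
    S (ModuleCat.of R
      (colonElem (listSMulTop (xs.take i) M) xs[i] ⧸
        (listSMulTop (xs.take i) M).submoduleOf
          (colonElem (listSMulTop (xs.take i) M) xs[i])))

/-- `S-Supp M`: the primes `p` in the support of `M` such that `R/p` is not in `S`. -/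
def serreSupport (S : ObjectProperty (ModuleCat.{u} R))
    (M : Type u) [AddCommGroup M] [Module R M] : Set (PrimeSpectrum R) :=
  {p | p ∈ Module.support R M ∧ ¬ S (ModuleCat.of R (R ⧸ p.asIdeal))}

/-- A system of parameters of a module `M` over a local ring: elements of the maximal ideal,
`dim M` in number, such that `M/(x₁, …, x_d)M` has finite length. -/
structure IsSystemOfParameters [IsLocalRing R] (M : Type u) [AddCommGroup M] [Module R M]
    (xs : List R) : Prop where
  mem_maximalIdeal : ∀ x ∈ xs, x ∈ IsLocalRing.maximalIdeal R
  length_eq : (xs.length : WithBot ℕ∞) = Module.supportDim R M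
  finiteLength : IsFiniteLength R (M ⧸ listSMulTop xs M)

/-- `M` is `S`-Cohen–Macaulay: every system of parameters of `M` is a weak `M`-sequence with
respect to `S`. -/
def IsSerreCohenMacaulay [IsLocalRing R] (S : ObjectProperty (ModuleCat.{u} R))
    (M : Type u) [AddCommGroup M] [Module R M] : Prop :=
  ∀ xs : List R, IsSystemOfParameters M xs → IsWeakSequence S M xs

end Sequences

section CohenMacaulayRings

/-- The depth of a local ring: the supremum of the lengths of regular sequences in its
maximal ideal. -/
noncomputable def localDepth (B : Type u) [CommRing B] [IsLocalRing B] : ℕ∞ :=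
  ⨆ (xs : List B) (_ : (∀ x ∈ xs, x ∈ IsLocalRing.maximalIdeal B) ∧
    RingTheory.Sequence.IsRegular B xs), (xs.length : ℕ∞)

/-- A local ring (always Noetherian below) is Cohen–Macaulay if its depth equals its
Krull dimension. -/
def IsCohenMacaulayLocalRing (B : Type u) [CommRing B] [IsLocalRing B] : Prop :=
  (localDepth B : WithBot ℕ∞) = ringKrullDim B

end CohenMacaulayRings

section BaseChange

variable (R : Type u) {A : Type u} [CommRing R] [CommRing A] [Algebra R A]

/-- For a class `S` of `A`-modules, `S^c` is the class of `R`-modules `N` such that the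
`A`-module `A ⊗ N` belongs to `S`. -/
def contractedClass (S : ObjectProperty (ModuleCat.{u} A)) : ObjectProperty (ModuleCat.{u} R) :=
  fun N => S (ModuleCat.of A (A ⊗[R] N))

/-- The ideal `f⁻¹(q)A` of `A`, where `f : R → A` is the structure map. -/
def contractExtend (q : Ideal A) : Ideal A :=
  (q.comap (algebraMap R A)).map (algebraMap R A)

theorem contractExtend_le (q : Ideal A) : contractExtend R q ≤ q :=
  Ideal.map_comap_le

/-- The ring `A_q / f⁻¹(q)A_q`. -/
abbrev FibreAt (q : Ideal A) [q.IsPrime] : Type u :=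
  Localization.AtPrime q ⧸
    (contractExtend R q).map (algebraMap A (Localization.AtPrime q))

instance (q : Ideal A) [q.IsPrime] : IsLocalRing (FibreAt R q) := by
  have hle : (contractExtend R q).map (algebraMap A (Localization.AtPrime q)) ≤
      IsLocalRing.maximalIdeal (Localization.AtPrime q) := by
    rw [← Localization.AtPrime.map_eq_maximalIdeal]
    exact Ideal.map_mono (contractExtend_le R q)
  have hne : (contractExtend R q).map (algebraMap A (Localization.AtPrime q)) ≠ ⊤ := fun h =>
    (IsLocalRing.maximalIdeal.isMaximal (Localization.AtPrime q)).ne_top (top_le_iff.1 (h ▸ hle))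
  have : Nontrivial (FibreAt R q) := Ideal.Quotient.nontrivial_iff.2 hne
  exact IsLocalRing.of_surjective' (Ideal.Quotient.mk _) Ideal.Quotient.mk_surjective

end BaseChange

end SerreCM

/-! The theorem reduces to a statement about single primes. Over a Noetherian local ring `A`, a
finite `N` is Cohen–Macaulay with respect to `S` iff every `q` in its `S`-support satisfies two
conditions: `N_q` is Cohen–Macaulay, and `dim N_q + dim A/q = dim N` (`isSerreCohenMacaulay_iff`).
The Serre property enters only through `IsSupportDetermined`: supports decide which finite modules
lie in `S`. That property descends to `S^c` along a flat map, so the criterion applies to `A ⊗ M`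
with `S` and to `M` with `S^c`.

Let `q` lie over `p`. The flat local map `R_p → A_q` has closed fibre `A_q/pA_q`, and `(A ⊗ M)_q` is
the base change of `M_p`. It is therefore Cohen–Macaulay iff `M_p` and the fibre are
(`IsCohenMacaulayModule.tensor`, `IsCohenMacaulayModule.of_tensor`). By the dimension formula
`supportDim_tensor_eq_add`, the dimension equality at `q` is the sum of the inequalities `dim M_p +
dim R/p ≤ dim M` and `ht(q/pA) + dim A/q ≤ dim A/pA`. It holds iff both of these are equalities
(`dimension_equality_iff`).

Contraction maps the `S`-support of `A ⊗ M` onto the `S^c`-support of `M`, by going down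
(`exists_mem_serreSupport_comap_eq`). The conditions at all `q` thus become the three conditions of
the theorem. -/

namespace SerreCM

open IsLocalRing Module RingTheory.Sequence

/-! ### Prime avoidance and dimension of supports. -/

section Dimension

variable {R : Type*} [CommRing R] {M N : Type*} [AddCommGroup M] [Module R M] [AddCommGroup N]
  [Module R N]

theorem exists_mem_forall_notMem_of_finite {I : Ideal R} {s : Set (Ideal R)} (hs : s.Finite)
    (hp : ∀ p ∈ s, p.IsPrime) (h : ∀ p ∈ s, ¬ I ≤ p) : ∃ x ∈ I, ∀ p ∈ s, x ∉ p := by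
  by_contra! hcon
  have hsub : (I : Set R) ⊆ ⋃ i ∈ (hs.toFinset : Set (Ideal R)), (i : Set R) := by
    intro x hx
    obtain ⟨p, hps, hxp⟩ := hcon x hx
    simp only [Set.Finite.coe_toFinset, Set.mem_iUnion]
    exact ⟨p, hps, hxp⟩
  rw [Ideal.subset_union_prime ⊤ ⊤ (fun i hi _ _ => hp i (by simpa using hi))] at hsub
  obtain ⟨p, hps, hle⟩ := hsub
  exact h p (by simpa using hps) hle

theorem supportDim_mono_of_support_subset (h : Module.support R M ⊆ Module.support R N) :
    supportDim R M ≤ supportDim R N :=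
  Order.krullDim_le_of_strictMono (fun a => ⟨a.1, h a.2⟩) fun _ _ lt => lt

theorem supportDim_congr_of_support_eq (h : Module.support R M = Module.support R N) :
    supportDim R M = supportDim R N :=
  (supportDim_mono_of_support_subset h.le).antisymm (supportDim_mono_of_support_subset h.ge)

theorem ringKrullDim_quotient_eq_coheight (p : PrimeSpectrum R) :
    ringKrullDim (R ⧸ p.asIdeal) = Order.coheight p := by
  rw [ringKrullDim_quotient, Order.coheight_eq_krullDim_Ici]
  rfl

/-- Supports are closed under specialization, so chains going up from `p` never leave the support.
-/
theorem coheight_support_eq (p : Module.support R M) :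
    Order.coheight p = Order.coheight p.1 :=
  Order.coheight_eq_of_strictMono (fun a : Module.support R M => a.1) (fun _ _ h => h)
    (fun a b hab => ⟨⟨b, mem_support_mono hab.le a.2⟩, hab, rfl⟩) p

theorem supportDim_le_iff {n : WithBot ℕ∞} :
    supportDim R M ≤ n ↔ ∀ p ∈ Module.support R M, ringKrullDim (R ⧸ p.asIdeal) ≤ n := by
  simp only [supportDim, Order.krullDim_eq_iSup_coheight, iSup_le_iff, coheight_support_eq,
    ringKrullDim_quotient_eq_coheight, Subtype.forall]

theorem ringKrullDim_quotient_le_supportDim {p : PrimeSpectrum R} (hp : p ∈ Module.support R M) :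
    ringKrullDim (R ⧸ p.asIdeal) ≤ supportDim R M :=
  supportDim_le_iff.1 le_rfl p hp

theorem ringKrullDim_quotient_add_one_le_of_lt {p q : PrimeSpectrum R} (h : p < q) :
    ringKrullDim (R ⧸ q.asIdeal) + 1 ≤ ringKrullDim (R ⧸ p.asIdeal) := by
  simp only [ringKrullDim_quotient_eq_coheight]
  exact_mod_cast Order.coheight_add_one_le h

theorem support_quotSMulTop_eq [Module.Finite R M] (x : R) :
    Module.support R (QuotSMulTop x M) = Module.support R M ∩ {p | x ∈ p.asIdeal} := by
  rw [support_quotSMulTop]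
  ext p
  simp

theorem support_quotient_ofList [Module.Finite R M] (xs : List R) :
    Module.support R (M ⧸ (Ideal.ofList xs • ⊤ : Submodule R M)) =
      Module.support R M ∩ {p | ∀ x ∈ xs, x ∈ p.asIdeal} := by
  rw [support_quotient]
  ext p
  simp [PrimeSpectrum.mem_zeroLocus, Ideal.ofList, Set.subset_def]

/-- Dimension sees only the support, so comparing supports replaces an isomorphism of iterated
quotients. -/
theorem supportDim_quotient_ofList_cons [Module.Finite R M] (x : R) (xs : List R) :
    supportDim R (M ⧸ (Ideal.ofList (x :: xs) • ⊤ : Submodule R M)) =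
      supportDim R (QuotSMulTop x M ⧸
        (Ideal.ofList xs • ⊤ : Submodule R (QuotSMulTop x M))) := by
  apply supportDim_congr_of_support_eq
  simp only [support_quotient_ofList, support_quotSMulTop_eq, List.forall_mem_cons]
  ext p
  simp [and_assoc]

theorem supportDim_quotient_ofList_nil [Module.Finite R M] :
    supportDim R (M ⧸ (Ideal.ofList ([] : List R) • ⊤ : Submodule R M)) = supportDim R M := by
  apply supportDim_congr_of_support_eq
  simp [support_quotient_ofList]

theorem supportDim_quotient_ofList_append [Module.Finite R M] (xs ys : List R) :
    supportDim R (M ⧸ (Ideal.ofList (xs ++ ys) • ⊤ : Submodule R M)) =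
      supportDim R ((M ⧸ (Ideal.ofList xs • ⊤ : Submodule R M)) ⧸
        (Ideal.ofList ys • ⊤ : Submodule R (M ⧸ (Ideal.ofList xs • ⊤ : Submodule R M)))) := by
  apply supportDim_congr_of_support_eq
  simp only [support_quotient_ofList]
  ext p
  simp [and_assoc, or_imp, forall_and]

end Dimension

/-! ### Parameters over a Noetherian local ring. -/

section LocalDimension

variable {R : Type*} [CommRing R] [IsNoetherianRing R] [IsLocalRing R]
  {M : Type*} [AddCommGroup M] [Module R M] [Module.Finite R M]

/-- Nonzero finite-dimensional supports have natural number dimension; this makes cancellation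
available in `WithBot ℕ∞`. -/
theorem exists_supportDim_eq_natCast (R : Type*) [CommRing R] [IsNoetherianRing R]
    [IsLocalRing R] (M : Type*) [AddCommGroup M] [Module R M] [Nontrivial M] :
    ∃ n : ℕ, supportDim R M = n := by
  have h1 : supportDim R M ≠ ⊥ := supportDim_ne_bot_of_nontrivial R M
  have h2 : supportDim R M < ⊤ := (supportDim_le_ringKrullDim R M).trans_lt ringKrullDim_lt_top
  obtain ⟨a, ha⟩ := WithBot.ne_bot_iff_exists.1 h1
  rw [← ha] at h2 ⊢
  have h3 : a ≠ ⊤ := by rintro rfl; exact lt_irrefl _ h2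
  obtain ⟨n, rfl⟩ := ENat.ne_top_iff_exists.1 h3
  exact ⟨n, rfl⟩

theorem exists_ringKrullDim_quotient_eq_natCast (p : PrimeSpectrum R) :
    ∃ n : ℕ, ringKrullDim (R ⧸ p.asIdeal) = n := by
  rw [← supportDim_quotient_eq_ringKrullDim]
  have : Nontrivial (R ⧸ p.asIdeal) := Ideal.Quotient.nontrivial_iff.2 p.2.ne_top
  exact exists_supportDim_eq_natCast R _

theorem supportDim_le_supportDim_quotient_ofList_add_length (xs : List R)
    (hxs : ∀ x ∈ xs, x ∈ maximalIdeal R) :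
    supportDim R M ≤
      supportDim R (M ⧸ (Ideal.ofList xs • ⊤ : Submodule R M)) + xs.length := by
  induction xs generalizing M with
  | nil => simp [supportDim_quotient_ofList_nil]
  | cons x xs ih =>
    rw [supportDim_quotient_ofList_cons]
    have h1 := supportDim_le_supportDim_quotSMulTop_succ (M := M) (hxs x (by simp))
    have h2 := ih (M := QuotSMulTop x M) fun y hy => hxs y (by simp [hy])
    calc _ ≤ _ := h1
      _ ≤ _ := add_le_add_left h2 1
      _ = _ := by rw [add_assoc]; simp

/-- A prime `q` in the support of `M` contains a part of a system of parameters of `M` of length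
`dim M - dim R/q`. -/
theorem exists_partial_parameters {q : PrimeSpectrum R} (hq : q ∈ Module.support R M) :
    ∃ xs : List R, (∀ x ∈ xs, x ∈ q.asIdeal) ∧
      ringKrullDim (R ⧸ q.asIdeal) + xs.length = supportDim R M ∧
      supportDim R (M ⧸ (Ideal.ofList xs • ⊤ : Submodule R M)) =
        ringKrullDim (R ⧸ q.asIdeal) := by
  have hnt : Nontrivial M := nonempty_support_iff.1 ⟨q, hq⟩
  obtain ⟨d, hd⟩ := exists_supportDim_eq_natCast R M
  induction d using Nat.strong_induction_on generalizing M with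
  | _ d ih =>
  by_cases hqd : ringKrullDim (R ⧸ q.asIdeal) = d
  · exact ⟨[], by simp, by simp [hqd, hd], by rw [supportDim_quotient_ofList_nil, hqd, hd]⟩
  have hqlt : ringKrullDim (R ⧸ q.asIdeal) < d :=
    (hd ▸ ringKrullDim_quotient_le_supportDim hq).lt_of_ne hqd
  -- Here `x` avoids the minimal primes `p` of dimension `d = dim M`. None of them contains `q`,
  -- since that would give `dim R/p ≤ dim R/q < d`.
  obtain ⟨x, hxq, hx⟩ := exists_mem_forall_notMem_of_finite (I := q.asIdeal)
    (s := {p | p ∈ (annihilator R M).minimalPrimes ∧ ringKrullDim (R ⧸ p) = d})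
    ((Ideal.finite_minimalPrimes_of_isNoetherianRing R _).subset fun p hp => hp.1)
    (fun p hp => hp.1.isPrime) (by
      rintro p ⟨hp, hpd⟩ hle
      have hpp := hp.isPrime
      have hqp : q ≤ ⟨p, hpp⟩ := hle
      rcases hqp.lt_or_eq with h | h
      · have := ringKrullDim_quotient_add_one_le_of_lt h
        have h2 := this.trans hqlt.le
        rw [hpd] at h2
        exact absurd (by exact_mod_cast h2 : d + 1 ≤ d) (by omega)
      · rw [h] at hqd
        exact hqd hpd)
  have hxm : x ∈ maximalIdeal R := le_maximalIdeal q.2.ne_top hxq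
  have hq' : q ∈ Module.support R (QuotSMulTop x M) := by
    rw [support_quotSMulTop_eq]; exact ⟨hq, hxq⟩
  have hnt' : Nontrivial (QuotSMulTop x M) := nonempty_support_iff.1 ⟨q, hq'⟩
  obtain ⟨e, he⟩ := exists_supportDim_eq_natCast R (QuotSMulTop x M)
  have hle := supportDim_le_supportDim_quotSMulTop_succ (M := M) hxm
  rw [hd, he] at hle
  have hle' : d ≤ e + 1 := by exact_mod_cast hle
  -- If the dimension did not drop, some `p` containing `x` would have dimension `d`. Such a `p` is
  -- minimal over the annihilator, since a smaller prime would have larger dimension, and `x` was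
  -- chosen to avoid it.
  have hed : e < d := by
    by_contra! hde
    have : ¬ supportDim R (QuotSMulTop x M) < d := by rw [he]; exact_mod_cast not_lt.2 hde
    apply this
    obtain ⟨d, rfl⟩ : ∃ d', d = d' + 1 := by
      obtain ⟨n, hn⟩ := exists_ringKrullDim_quotient_eq_natCast q
      rw [hn] at hqlt
      exact ⟨d - 1, by have : n < d := (by exact_mod_cast hqlt); omega⟩
    refine lt_of_le_of_lt (b := (d : WithBot ℕ∞)) ?_ (by exact_mod_cast Nat.lt_succ_self d)
    rw [supportDim_le_iff]
    intro p hp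
    rw [support_quotSMulTop_eq] at hp
    by_contra! hlt
    obtain ⟨n, hn⟩ := exists_ringKrullDim_quotient_eq_natCast p
    have hnd := ringKrullDim_quotient_le_supportDim hp.1
    rw [hn] at hlt
    rw [hn, hd] at hnd
    have hnd' : n = d + 1 := le_antisymm (by exact_mod_cast hnd) (by exact_mod_cast hlt)
    subst hnd'
    refine hx p.asIdeal ⟨?_, hn⟩ hp.2
    obtain ⟨p', hp', hle⟩ := Ideal.exists_minimalPrimes_le (annihilator_le_of_mem_support hp.1)
    have hpp := hp'.isPrime
    have hpl : (⟨p', hpp⟩ : PrimeSpectrum R) ≤ p := hle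
    rcases hpl.lt_or_eq with h | h
    · have h1 := ringKrullDim_quotient_add_one_le_of_lt h
      have h2 := ringKrullDim_quotient_le_supportDim (M := M) (p := ⟨p', hpp⟩)
        (mem_support_iff_of_finite.2 hp'.le)
      have h3 := h1.trans h2
      rw [hn, hd] at h3
      exact absurd (by exact_mod_cast h3 : d + 1 + 1 ≤ d + 1) (by omega)
    · rw [← h]; exact hp'
  obtain rfl : d = e + 1 := by omega
  obtain ⟨xs, h1, h2, h3⟩ := ih e hed hq' hnt' he
  refine ⟨x :: xs, by simpa using ⟨hxq, h1⟩, ?_, by rw [supportDim_quotient_ofList_cons, h3]⟩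
  rw [hd, List.length_cons]
  push_cast
  rw [← add_assoc, h2, he]

/-- Systems of parameters exist. -/
theorem exists_parameters [Nontrivial M] :
    ∃ xs : List R, (∀ x ∈ xs, x ∈ maximalIdeal R) ∧ (xs.length : WithBot ℕ∞) = supportDim R M ∧
      supportDim R (M ⧸ (Ideal.ofList xs • ⊤ : Submodule R M)) = 0 := by
  obtain ⟨xs, h1, h2, h3⟩ := exists_partial_parameters (closedPoint_mem_support R M)
  have h0 : ringKrullDim (R ⧸ (closedPoint R).asIdeal) = 0 :=
    ringKrullDim_eq_zero_of_field (ResidueField R)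
  rw [h0] at h2 h3
  exact ⟨xs, h1, by simpa using h2, h3⟩

end LocalDimension

/-! ### Cohen–Macaulay modules: parameters are regular. -/

section CohenMacaulayModules

theorem isSMulRegular_iff_forall_associatedPrimes {R M : Type*} [CommRing R]
    [IsNoetherianRing R] [AddCommGroup M] [Module R M] {x : R} :
    IsSMulRegular M x ↔ ∀ p ∈ associatedPrimes R M, x ∉ p := by
  have h := biUnion_associatedPrimes_eq_compl_regular R M
  have h' : x ∈ (⋃ p ∈ associatedPrimes R M, (p : Set R)) ↔ x ∈ {r | IsSMulRegular M r}ᶜ := by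
    rw [h]
  simp only [Set.mem_iUnion, Set.mem_compl_iff, Set.mem_ofPred_eq] at h'
  rw [← not_iff_not, ← h']
  push Not
  simp

variable {R : Type*} [CommRing R] [IsLocalRing R]

/-- A nonzero module over a local ring is Cohen–Macaulay if it has a regular sequence in the
maximal ideal whose length is its dimension. -/
def IsCohenMacaulayModule (R : Type*) [CommRing R] [IsLocalRing R] (M : Type*) [AddCommGroup M]
    [Module R M] : Prop :=
  ∃ rs : List R, (∀ r ∈ rs, r ∈ maximalIdeal R) ∧ IsWeaklyRegular M rs ∧
    supportDim R M = rs.length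

variable {M N : Type*} [AddCommGroup M] [Module R M] [AddCommGroup N] [Module R N]

theorem IsCohenMacaulayModule.nontrivial (h : IsCohenMacaulayModule R M) : Nontrivial M := by
  obtain ⟨rs, -, -, h⟩ := h
  rw [← supportDim_ne_bot_iff_nontrivial R, h]
  exact WithBot.coe_ne_bot

theorem isCohenMacaulayModule_congr (e : M ≃ₗ[R] N) :
    IsCohenMacaulayModule R M ↔ IsCohenMacaulayModule R N := by
  simp only [IsCohenMacaulayModule, e.isWeaklyRegular_congr, supportDim_eq_of_equiv e]

variable [IsNoetherianRing R] [Module.Finite R M]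

theorem IsCohenMacaulayModule.of_quotSMulTop {x : R} (hx : x ∈ maximalIdeal R)
    (hreg : IsSMulRegular M x) (h : IsCohenMacaulayModule R (QuotSMulTop x M)) :
    IsCohenMacaulayModule R M := by
  obtain ⟨rs, h1, h2, h3⟩ := h
  refine ⟨x :: rs, by simpa using ⟨hx, h1⟩, (isWeaklyRegular_cons_iff M x rs).2 ⟨hreg, h2⟩, ?_⟩
  rw [← supportDim_quotSMulTop_succ_eq_supportDim hreg hx, h3]
  simp

theorem isSMulRegular_swap {x y : R} (hx : x ∈ maximalIdeal R) (hy : y ∈ maximalIdeal R)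
    (h1 : IsSMulRegular M x) (h2 : IsSMulRegular (QuotSMulTop x M) y) :
    IsSMulRegular M y ∧ IsSMulRegular (QuotSMulTop y M) x := by
  have h : IsWeaklyRegular M [x, y] := by simp [h1, h2]
  have h' := IsLocalRing.isWeaklyRegular_of_perm_of_subset_maximalIdeal h
    (List.Perm.swap y x []) (by
      intro r hr
      rcases List.mem_pair.1 hr with rfl | rfl <;> assumption)
  simpa using h'

/-- The iterated quotients `(M/xM)/yM` and `(M/yM)/xM` are isomorphic. -/
noncomputable def quotSMulTopComm (x y : R) (M : Type*) [AddCommGroup M] [Module R M] :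
    QuotSMulTop y (QuotSMulTop x M) ≃ₗ[R] QuotSMulTop x (QuotSMulTop y M) :=
  QuotSMulTop.equivQuotTensor y _ ≪≫ₗ
    (QuotSMulTop.equivQuotTensor x M).lTensor _ ≪≫ₗ
    TensorProduct.leftComm R _ _ _ ≪≫ₗ
    ((QuotSMulTop.equivQuotTensor y M).lTensor _).symm ≪≫ₗ
    (QuotSMulTop.equivQuotTensor x _).symm

/-- A parameter on a Cohen–Macaulay module is regular, and the quotient is Cohen–Macaulay. -/
theorem IsCohenMacaulayModule.isSMulRegular_of_parameter (h : IsCohenMacaulayModule R M) {y : R}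
    (hy : y ∈ maximalIdeal R) (hdim : supportDim R (QuotSMulTop y M) + 1 ≤ supportDim R M) :
    IsSMulRegular M y ∧ IsCohenMacaulayModule R (QuotSMulTop y M) := by
  obtain ⟨n, hn⟩ : ∃ n : ℕ, supportDim R M = n :=
    h.elim fun rs hrs => ⟨rs.length, hrs.2.2⟩
  induction n using Nat.strong_induction_on generalizing M y with
  | _ n ih =>
  have hnt := h.nontrivial
  have hnty := nontrivial_quotSMulTop_of_mem_maximalIdeal M hy
  obtain ⟨rs, hrs, hreg, hlen⟩ := h
  have hlen' : rs.length = n := by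
    rw [hn] at hlen; exact_mod_cast hlen.symm
  obtain ⟨e, he⟩ := exists_supportDim_eq_natCast R (QuotSMulTop y M)
  have hen : e + 1 = n := by
    have h1 := supportDim_le_supportDim_quotSMulTop_succ (M := M) hy
    rw [hn, he] at h1 hdim
    exact le_antisymm (by exact_mod_cast hdim) (by exact_mod_cast h1)
  match rs, hlen' with
  | [], hlen' => simp at hlen'; omega
  | [x], hlen' =>
    obtain rfl : e = 0 := by simp at hlen'; omega
    refine ⟨?_, [], by simp, by simp, by simpa using he⟩
    -- In dimension one, an associated prime containing `y` lies in the support of `M/yM`. It is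
    -- then the maximal ideal, so it contains the regular element `x`.
    have hx : IsSMulRegular M x := by simpa using hreg
    rw [isSMulRegular_iff_forall_associatedPrimes] at hx ⊢
    intro p hp hyp
    have hpp : p.IsPrime := hp.isPrime
    have hps : (⟨p, hpp⟩ : PrimeSpectrum R) ∈ Module.support R M :=
      mem_support_iff_of_finite.2 (by
        simpa [Submodule.annihilator_top] using (AssociatedPrimes.mem_iff.1 hp).annihilator_le)
    have hps' : (⟨p, hpp⟩ : PrimeSpectrum R) ∈ Module.support R (QuotSMulTop y M) := by
      rw [support_quotSMulTop_eq]; exact ⟨hps, hyp⟩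
    have := support_of_supportDim_eq_zero (R := R) (N := QuotSMulTop y M) (by simpa using he)
    rw [this] at hps'
    exact hx p hp (hps' (hrs x (by simp)))
  | x₁ :: x₂ :: rs, hlen' =>
    simp only [isWeaklyRegular_cons_iff] at hreg
    have hx₁ := hrs x₁ (by simp)
    have hx₂ := hrs x₂ (by simp)
    -- The auxiliary `z` is to be regular on `M/x₁M` and a parameter on `M/yM`. It exists because
    -- `x₂` is regular on `M/x₁M` and `dim M/yM = e > 0`.
    obtain ⟨z, hz, hzs⟩ := exists_mem_forall_notMem_of_finite (I := maximalIdeal R)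
      (s := associatedPrimes R (QuotSMulTop x₁ M) ∪
        (annihilator R (QuotSMulTop y M)).minimalPrimes)
      ((associatedPrimes.finite R _).union (Ideal.finite_minimalPrimes_of_isNoetherianRing R _))
      (by
        rintro p (hp | hp)
        · exact hp.isPrime
        · exact hp.isPrime) (by
        rintro p (hp | hp) hle
        · exact isSMulRegular_iff_forall_associatedPrimes.1 hreg.2.1 p hp (hle hx₂)
        · have : supportDim R (QuotSMulTop y M) ≤ 0 := by
            rw [supportDim_le_iff]
            intro q hq
            have hq1 := annihilator_le_of_mem_support hq
            have hq2 : q.asIdeal ≤ p := (le_maximalIdeal q.2.ne_top).trans hle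
            have hqp : q.asIdeal = maximalIdeal R :=
              (le_maximalIdeal q.2.ne_top).antisymm (hle.trans (hp.2 ⟨q.2, hq1⟩ hq2))
            rw [hqp]
            exact (ringKrullDim_eq_zero_of_field (ResidueField R)).le
          rw [he] at this
          have : e ≤ 0 := by exact_mod_cast this
          simp at hlen'
          omega)
    have hz₁ : IsSMulRegular (QuotSMulTop x₁ M) z :=
      isSMulRegular_iff_forall_associatedPrimes.2 fun p hp => hzs p (Or.inl hp)
    have hzy : supportDim R (QuotSMulTop z (QuotSMulTop y M)) + 1 ≤
        supportDim R (QuotSMulTop y M) :=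
      supportDim_quotSMulTop_succ_le_of_notMem_minimalPrimes fun p hp => hzs p (Or.inr hp)
    obtain ⟨hzM, hx₁z⟩ := isSMulRegular_swap hx₁ hz hreg.1 hz₁
    have hdimx := supportDim_quotSMulTop_succ_eq_supportDim hreg.1 hx₁
    have hdimz := supportDim_quotSMulTop_succ_eq_supportDim hzM hz
    have hnt₁ := nontrivial_quotSMulTop_of_mem_maximalIdeal M hx₁
    have hntz := nontrivial_quotSMulTop_of_mem_maximalIdeal M hz
    have cancel {X : Type _} [AddCommGroup X] [Module R X] [Nontrivial X]
        (hX : supportDim R X + 1 = supportDim R M) : supportDim R X = e := by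
      obtain ⟨k, hk⟩ := exists_supportDim_eq_natCast R X
      rw [hk, hn] at hX
      have : k + 1 = n := by exact_mod_cast hX
      rw [hk]
      congr
      omega
    -- The Cohen–Macaulay property passes from `M/x₁M` to `M/(x₁, z)M`, up to `M/zM`, down to `M/(z,
    -- y)M` and up to `M/yM`. The two descents use induction and the two ascents use swapped regular
    -- pairs.
    have hCM₁ : IsCohenMacaulayModule R (QuotSMulTop x₁ M) := by
      refine ⟨x₂ :: rs, fun r hr => hrs r (List.mem_cons_of_mem _ hr), ?_, ?_⟩
      · simpa using hreg.2
      · rw [cancel hdimx]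
        congr 1
        simp at hlen' ⊢
        omega
    have hCMz : IsCohenMacaulayModule R (QuotSMulTop z M) := by
      refine .of_quotSMulTop hx₁ hx₁z ((isCohenMacaulayModule_congr (quotSMulTopComm x₁ z M)).1 ?_)
      exact (ih e (by omega) hCM₁ hz
        (supportDim_quotSMulTop_succ_eq_supportDim hz₁ hz).le (cancel hdimx)).2
    obtain ⟨hyz, hCMzy⟩ := ih e (by omega) hCMz hy (by
      rw [cancel hdimz, ← he, ← supportDim_eq_of_equiv (quotSMulTopComm y z M)]
      exact hzy) (cancel hdimz)
    obtain ⟨hyM, hzy'⟩ := isSMulRegular_swap hz hy hzM hyz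
    exact ⟨hyM, .of_quotSMulTop hz hzy' ((isCohenMacaulayModule_congr
      (quotSMulTopComm z y M)).1 hCMzy)⟩

/-- Every part of a system of parameters of a Cohen–Macaulay module is a regular sequence. -/
theorem IsCohenMacaulayModule.isWeaklyRegular (h : IsCohenMacaulayModule R M) (xs : List R)
    (hxs : ∀ x ∈ xs, x ∈ maximalIdeal R)
    (hdim : supportDim R (M ⧸ (Ideal.ofList xs • ⊤ : Submodule R M)) + xs.length ≤
      supportDim R M) : IsWeaklyRegular M xs := by
  induction xs generalizing M with
  | nil => simp
  | cons x xs ih =>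
    have hx := hxs x (by simp)
    have hxs' : ∀ y ∈ xs, y ∈ maximalIdeal R := fun y hy => hxs y (by simp [hy])
    rw [supportDim_quotient_ofList_cons] at hdim
    -- The remaining elements lower the dimension by at most one each, so `x` itself must lower it.
    have h1 := supportDim_le_supportDim_quotient_ofList_add_length (M := QuotSMulTop x M) xs hxs'
    have hnt := h.nontrivial
    have hntx := nontrivial_quotSMulTop_of_mem_maximalIdeal M hx
    have hdim' : supportDim R (QuotSMulTop x M ⧸
        (Ideal.ofList xs • ⊤ : Submodule R (QuotSMulTop x M))) + xs.length + 1 ≤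
        supportDim R M := by
      rw [add_assoc]; simpa using hdim
    obtain ⟨hreg, hCM⟩ := h.isSMulRegular_of_parameter hx ((add_le_add_left h1 1).trans hdim')
    refine (isWeaklyRegular_cons_iff M x xs).2 ⟨hreg, ih hCM hxs' ?_⟩
    rw [← supportDim_quotSMulTop_succ_eq_supportDim hreg hx] at hdim'
    exact (ENat.WithBot.add_le_add_one_right_iff).1 hdim'

end CohenMacaulayModules

/-! ### Finite length and dimension zero. -/

section FiniteLength

variable {R : Type*} [CommRing R] [IsNoetherianRing R] [IsLocalRing R]
  {M : Type*} [AddCommGroup M] [Module R M]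

/-- In a filtration with factors `R/p`, every `p` lies in the support, so every factor is the
residue field. -/
theorem isFiniteLength_of_support_subset [Module.Finite R M]
    (h : ∀ p ∈ Module.support R M, p.asIdeal = maximalIdeal R) : IsFiniteLength R M := by
  induction ‹Module.Finite R M› using
    IsNoetherianRing.induction_on_isQuotientEquivQuotientPrime R with
  | subsingleton N => exact .of_subsingleton
  | quotient N p e =>
    have hp := h p (by
      rw [e.support_eq, mem_support_iff_of_finite, Ideal.annihilator_quotient])
    have : IsSimpleModule R N :=
      isSimpleModule_iff_quot_maximal.2 ⟨p.asIdeal, hp ▸ inferInstance, ⟨e⟩⟩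
    rw [isFiniteLength_iff_isNoetherian_isArtinian]
    exact ⟨inferInstance, inferInstance⟩
  | exact N₁ N₂ N₃ f g hf hg hfg ih₁ ih₃ =>
    rw [support_of_exact hfg hf hg] at h
    have h₁ := isFiniteLength_iff_isNoetherian_isArtinian.1 (ih₁ fun p hp => h p (Or.inl hp))
    have h₃ := isFiniteLength_iff_isNoetherian_isArtinian.1 (ih₃ fun p hp => h p (Or.inr hp))
    have := h₁.2
    have := h₃.2
    exact isFiniteLength_iff_isNoetherian_isArtinian.2
      ⟨inferInstance, isArtinian_of_range_eq_ker f g (LinearMap.exact_iff.1 hfg).symm⟩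

theorem support_subset_of_isFiniteLength {R M : Type*} [CommRing R] [IsLocalRing R]
    [AddCommGroup M] [Module R M] (h : IsFiniteLength R M) :
    ∀ p ∈ Module.support R M, p.asIdeal = maximalIdeal R := by
  induction h with
  | of_subsingleton => intro p hp; simp [support_eq_empty] at hp
  | @of_simple_quotient M _ _ N hs _ ih =>
    intro p hp
    rw [support_of_exact (LinearMap.exact_subtype_mkQ N) N.injective_subtype
      N.mkQ_surjective] at hp
    rcases hp with hp | hp
    · exact ih p hp
    · obtain ⟨I, hI, ⟨e⟩⟩ := isSimpleModule_iff_quot_maximal.1 hs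
      rw [e.support_eq, mem_support_iff_of_finite, Ideal.annihilator_quotient] at hp
      rw [← eq_maximalIdeal hI]
      exact (hI.eq_of_le p.2.ne_top hp).symm

theorem supportDim_le_zero_iff [Module.Finite R M] :
    supportDim R M ≤ 0 ↔ ∀ p ∈ Module.support R M, p.asIdeal = maximalIdeal R := by
  refine ⟨fun h p hp => ?_, fun h => supportDim_le_iff.2 fun p hp => ?_⟩
  · have := nonempty_support_iff.1 ⟨p, hp⟩
    obtain ⟨n, hn⟩ := exists_supportDim_eq_natCast R M
    have h0 : supportDim R M = 0 := by
      rw [hn] at h ⊢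
      have : n ≤ 0 := by exact_mod_cast h
      simpa using this
    rw [support_of_supportDim_eq_zero (R := R) (N := M) h0] at hp
    exact (le_maximalIdeal p.2.ne_top).antisymm hp
  · rw [h p hp]
    exact (ringKrullDim_eq_zero_of_field (ResidueField R)).le

/-- The bound `≤ 0` covers the zero module, whose dimension is `⊥`. -/
theorem isFiniteLength_iff_supportDim_le_zero [Module.Finite R M] :
    IsFiniteLength R M ↔ supportDim R M ≤ 0 := by
  rw [supportDim_le_zero_iff]
  exact ⟨support_subset_of_isFiniteLength, isFiniteLength_of_support_subset⟩

theorem exists_injective_residue_of_supportDim_eq_zero [Module.Finite R M]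
    (h : supportDim R M = 0) :
    ∃ f : (R ⧸ maximalIdeal R) →ₗ[R] M, Function.Injective f := by
  have : Nontrivial M := by
    rw [← supportDim_ne_bot_iff_nontrivial R, h]; exact WithBot.coe_ne_bot
  obtain ⟨p, hp⟩ := associatedPrimes.nonempty R M
  obtain ⟨hpp, f, hf⟩ := (isAssociatedPrime_iff_exists_injective_linearMap p M).1 hp
  have hps : (⟨p, hpp⟩ : PrimeSpectrum R) ∈ Module.support R M :=
    mem_support_iff_of_finite.2 (by
      simpa [Submodule.annihilator_top] using (AssociatedPrimes.mem_iff.1 hp).annihilator_le)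
  obtain rfl := supportDim_le_zero_iff.1 h.le _ hps
  exact ⟨f, hf⟩

/-- Take the first member of a system of parameters: the other `n` bound the dimension of the
quotient above, and one element lowers dimension by at most one. -/
theorem exists_parameter [Module.Finite R M] {n : ℕ} (h : supportDim R M = (n + 1 : ℕ)) :
    ∃ x ∈ maximalIdeal R, supportDim R (QuotSMulTop x M) = n := by
  have : Nontrivial M := by
    rw [← supportDim_ne_bot_iff_nontrivial R, h]; exact WithBot.coe_ne_bot
  obtain ⟨xs, hxs, hlen, hdim⟩ := exists_parameters (R := R) (M := M)
  rw [h] at hlen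
  have hlen' : xs.length = n + 1 := by exact_mod_cast hlen
  match xs, hlen' with
  | x :: xs, hlen' =>
    have hx := hxs x (by simp)
    refine ⟨x, hx, le_antisymm ?_ ?_⟩
    · have h1 := supportDim_le_supportDim_quotient_ofList_add_length (M := QuotSMulTop x M) xs
        fun y hy => hxs y (by simp [hy])
      rw [← supportDim_quotient_ofList_cons, hdim] at h1
      simp only [List.length_cons, add_left_inj] at hlen'
      simpa [hlen'] using h1
    · have h1 := supportDim_le_supportDim_quotSMulTop_succ (M := M) hx
      rw [h, Nat.cast_add, Nat.cast_one] at h1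
      exact (ENat.WithBot.add_le_add_one_right_iff).1 h1

end FiniteLength

/-! ### Regular sequences on a flat module and on its closed fibre. -/

section FlatRegular

variable {R A B : Type*} [CommRing R] [CommRing A] [Algebra R A] [AddCommGroup B] [Module R B]
  [Module A B] [IsScalarTower R A B]

theorem finite_tensorProduct_left [Module.Finite A B] (L : Type*) [AddCommGroup L] [Module R L]
    [Module.Finite R L] : Module.Finite A (B ⊗[R] L) :=
  Module.Finite.equiv (TensorProduct.AlgebraTensorModule.cancelBaseChange R A A B L)

/-- `(B/yB) ⊗ L` is `(B ⊗ L)/y(B ⊗ L)`. -/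
noncomputable def quotSMulTopTensorEquiv (y : A) (B : Type*) [AddCommGroup B] [Module R B]
    [Module A B] [IsScalarTower R A B] (L : Type*) [AddCommGroup L] [Module R L] :
    (QuotSMulTop y B) ⊗[R] L ≃ₗ[A] QuotSMulTop y (B ⊗[R] L) :=
  TensorProduct.AlgebraTensorModule.congr (QuotSMulTop.equivQuotTensor y B)
      (LinearEquiv.refl R L) ≪≫ₗ
    TensorProduct.AlgebraTensorModule.assoc R A A (A ⧸ Ideal.span {y}) B L ≪≫ₗ
    (QuotSMulTop.equivQuotTensor y (B ⊗[R] L)).symm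

theorem lTensor_smul_of_tower {L L' : Type*} [AddCommGroup L] [Module R L] [AddCommGroup L']
    [Module R L'] (f : L →ₗ[R] L') (y : A) (t : B ⊗[R] L) :
    LinearMap.lTensor B f (y • t) = y • LinearMap.lTensor B f t :=
  map_smul (TensorProduct.AlgebraTensorModule.lTensor A B f) y t

theorem rTensor_lsmul_apply (L : Type*) [AddCommGroup L] [Module R L] (y : A) (t : B ⊗[R] L) :
    LinearMap.rTensor L ((LinearMap.lsmul A B y).restrictScalars R) t = y • t := by
  induction t with
  | zero => simp
  | tmul b l => simp [TensorProduct.smul_tmul']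
  | add a b ha hb => simp [ha, hb]

/-- The quotient map `B → B/yB`, as an `R`-linear map. -/
def quotSMulTopMk (y : A) : B →ₗ[R] QuotSMulTop y B :=
  (Submodule.mkQ _).restrictScalars R

theorem quotSMulTopMk_surjective (y : A) :
    Function.Surjective (quotSMulTopMk (R := R) (B := B) y) := by
  intro q
  obtain ⟨b, rfl⟩ := Submodule.Quotient.mk_surjective _ q
  exact ⟨b, rfl⟩

theorem exact_lsmul_quotSMulTopMk (y : A) :
    Function.Exact ((LinearMap.lsmul A B y).restrictScalars R)
      (quotSMulTopMk (R := R) (B := B) y) := by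
  intro b
  refine (Submodule.Quotient.mk_eq_zero _).trans ?_
  rw [Submodule.mem_smul_pointwise_iff_exists]
  simp

theorem isSMulRegular_tensor_of_exact [Module.Flat R B] {L₁ L₂ L₃ : Type*} [AddCommGroup L₁]
    [Module R L₁] [AddCommGroup L₂] [Module R L₂] [AddCommGroup L₃] [Module R L₃]
    {f : L₁ →ₗ[R] L₂} {g : L₂ →ₗ[R] L₃} (hf : Function.Injective f) (hg : Function.Surjective g)
    (hfg : Function.Exact f g) {y : A} (h₁ : IsSMulRegular (B ⊗[R] L₁) y)
    (h₃ : IsSMulRegular (B ⊗[R] L₃) y) : IsSMulRegular (B ⊗[R] L₂) y :=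
  isSMulRegular_of_range_eq_ker
    (f := TensorProduct.AlgebraTensorModule.lTensor A B f)
    (g := TensorProduct.AlgebraTensorModule.lTensor A B g)
    (Module.Flat.lTensor_preserves_injective_linearMap f hf)
    (LinearMap.exact_iff.1 (show Function.Exact (TensorProduct.AlgebraTensorModule.lTensor A B f)
      (TensorProduct.AlgebraTensorModule.lTensor A B g) from lTensor_exact B hfg hg)).symm h₁ h₃

theorem isSMulRegular_tensor_of_isFiniteLength [IsLocalRing R] [Module.Flat R B] {y : A}
    (h : IsSMulRegular (B ⊗[R] (R ⧸ maximalIdeal R)) y) {L : Type*} [AddCommGroup L]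
    [Module R L] (hL : IsFiniteLength R L) : IsSMulRegular (B ⊗[R] L) y := by
  induction hL with
  | of_subsingleton => exact fun a b _ => Subsingleton.elim a b
  | @of_simple_quotient M _ _ N hs _ ih =>
    refine isSMulRegular_tensor_of_exact N.injective_subtype N.mkQ_surjective
      (LinearMap.exact_subtype_mkQ N) ih ?_
    obtain ⟨I, hI, ⟨e⟩⟩ := isSimpleModule_iff_quot_maximal.1 hs
    obtain rfl := eq_maximalIdeal hI
    exact ((TensorProduct.AlgebraTensorModule.congr (LinearEquiv.refl A B)
      e).isSMulRegular_congr y).2 h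

/-- The kernel of `y` on `B ⊗ R/I` is `Tor₁(Q, R/I)`, so its vanishing for all `I` is flatness of
`Q`. The proof is the corresponding diagram chase. -/
theorem flat_of_exact_lsmul [Module.Flat R B] {y : A}
    (h : ∀ I : Ideal R, IsSMulRegular (B ⊗[R] (R ⧸ I)) y) {Q : Type*} [AddCommGroup Q]
    [Module R Q] {π : B →ₗ[R] Q} (hπ : Function.Surjective π)
    (hyπ : Function.Exact ((LinearMap.lsmul A B y).restrictScalars R) π) :
    Module.Flat R Q := by
  rw [Module.Flat.iff_lTensor_injective']
  intro I
  rw [injective_iff_map_eq_zero]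
  intro t ht
  obtain ⟨t, rfl⟩ := LinearMap.rTensor_surjective I hπ t
  have h1 : LinearMap.rTensor R π (LinearMap.lTensor B I.subtype t) = 0 := by
    rw [← ht, ← LinearMap.comp_apply, ← LinearMap.comp_apply, LinearMap.rTensor_comp_lTensor,
      LinearMap.lTensor_comp_rTensor]
  -- The lift of `t` becomes `y • s` in `B ⊗ R`. Regularity on `B ⊗ R/I` pulls `s` back to `B ⊗ I`;
  -- flatness of `B` then makes the lift a multiple of `y` there, so `t` vanishes.
  obtain ⟨s, hs⟩ := (rTensor_exact R hyπ hπ _).1 h1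
  rw [rTensor_lsmul_apply] at hs
  have hex : Function.Exact (LinearMap.lTensor B I.subtype) (LinearMap.lTensor B I.mkQ) :=
    lTensor_exact B (LinearMap.exact_subtype_mkQ I) I.mkQ_surjective
  have h2 : LinearMap.lTensor B I.mkQ s = 0 := by
    apply isSMulRegular_iff_right_eq_zero_of_smul.1 (h I)
    rw [← lTensor_smul_of_tower, hs]
    exact (hex _).2 ⟨t, rfl⟩
  obtain ⟨s', rfl⟩ := (hex _).1 h2
  rw [← lTensor_smul_of_tower] at hs
  have hs' := Module.Flat.lTensor_preserves_injective_linearMap (M := B) I.subtype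
    I.injective_subtype hs
  rw [← hs', ← rTensor_lsmul_apply]
  exact (rTensor_exact I hyπ hπ _).2 ⟨s', rfl⟩

theorem flat_quotSMulTop_of_isSMulRegular [Module.Flat R B] {y : A}
    (h : ∀ I : Ideal R, IsSMulRegular (B ⊗[R] (R ⧸ I)) y) :
    Module.Flat R (QuotSMulTop y B) :=
  flat_of_exact_lsmul h (quotSMulTopMk_surjective y) (exact_lsmul_quotSMulTopMk (R := R) (B := B) y)

variable [IsNoetherianRing R] [IsLocalRing R] [IsNoetherianRing A] [IsLocalRing A]
  [IsLocalHom (algebraMap R A)] [Module.Finite A B] [Module.Flat R B]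

/-- If `y` is regular on the closed fibre `B/𝔪B` of a flat module, it is regular on `B ⊗ L` for
every finitely generated `L`. -/
theorem isSMulRegular_tensor_of_closedFibre {y : A}
    (h : IsSMulRegular (B ⊗[R] (R ⧸ maximalIdeal R)) y) (L : Type*) [AddCommGroup L]
    [Module R L] [Module.Finite R L] : IsSMulRegular (B ⊗[R] L) y := by
  have := finite_tensorProduct_left (R := R) (A := A) (B := B) L
  rw [isSMulRegular_iff_right_eq_zero_of_smul]
  intro t ht
  -- Krull's intersection theorem reduces the claim to each power `n`. There `y` is regular on `B ⊗
  -- L/𝔪ⁿL`, a base change of a finite length module, so `t` comes from `B ⊗ 𝔪ⁿL`.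
  suffices t ∈ ⨅ n : ℕ, (maximalIdeal A) ^ n • (⊤ : Submodule A (B ⊗[R] L)) by
    rwa [Ideal.iInf_pow_smul_eq_bot_of_isLocalRing _ (Ideal.IsPrime.ne_top')] at this
  rw [Submodule.mem_iInf]
  intro n
  let K : Submodule R L := (maximalIdeal R) ^ n • ⊤
  have hfl : IsFiniteLength R (L ⧸ K) := by
    apply isFiniteLength_of_support_subset
    intro p hp
    have hp' := annihilator_le_of_mem_support hp
    have : (maximalIdeal R) ^ n ≤ p.asIdeal := by
      refine le_trans ?_ hp'
      intro r hr
      rw [mem_annihilator]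
      intro l
      obtain ⟨l, rfl⟩ := K.mkQ_surjective l
      rw [← map_smul]
      exact (Submodule.Quotient.mk_eq_zero _).2 (Submodule.smul_mem_smul hr trivial)
    exact (le_maximalIdeal p.2.ne_top).antisymm (p.2.le_of_pow_le this)
  have h1 : LinearMap.lTensor B K.mkQ t = 0 := by
    apply isSMulRegular_iff_right_eq_zero_of_smul.1
      (isSMulRegular_tensor_of_isFiniteLength h hfl)
    rw [← lTensor_smul_of_tower, ht, map_zero]
  obtain ⟨s, rfl⟩ := (lTensor_exact B (LinearMap.exact_subtype_mkQ K) K.mkQ_surjective _).1 h1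
  clear ht h1
  induction s with
  | zero => simp
  | add a b ha hb => rw [map_add]; exact add_mem ha hb
  | tmul b l =>
    obtain ⟨l, hl⟩ := l
    simp only [LinearMap.lTensor_tmul, Submodule.subtype_apply]
    refine Submodule.smul_induction_on hl (fun r hr l _ => ?_) fun a c ha hc => ?_
    · have : b ⊗ₜ[R] (r • l) = algebraMap R A r • (b ⊗ₜ[R] l) := by
        rw [TensorProduct.tmul_smul, algebraMap_smul]
      rw [this]
      refine Submodule.smul_mem_smul ?_ trivial
      have h3 := Ideal.mem_map_of_mem (algebraMap R A) hr
      rw [Ideal.map_pow] at h3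
      exact Ideal.pow_right_mono
        (((local_hom_TFAE (algebraMap R A)).out 0 2).1 ‹IsLocalHom (algebraMap R A)›) n h3
    · rw [TensorProduct.tmul_add]; exact add_mem ha hc

/-- A general module `B` in place of `A` lets the induction pass to `B/yB`, which is again flat over
`R` and finite over `A`. -/
theorem isWeaklyRegular_tensor_of_closedFibre {R A B : Type u} [CommRing R] [CommRing A]
    [Algebra R A] [AddCommGroup B] [Module R B] [Module A B] [IsScalarTower R A B]
    [IsNoetherianRing R] [IsLocalRing R] [IsNoetherianRing A] [IsLocalRing A]
    [IsLocalHom (algebraMap R A)] [Module.Finite A B] [Module.Flat R B] {ys : List A}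
    (h : IsWeaklyRegular (B ⊗[R] (R ⧸ maximalIdeal R)) ys) (L : Type u) [AddCommGroup L]
    [Module R L] [Module.Finite R L] : IsWeaklyRegular (B ⊗[R] L) ys := by
  induction ys generalizing B with
  | nil => simp
  | cons y ys ih =>
    rw [isWeaklyRegular_cons_iff] at h ⊢
    have hflat : Module.Flat R (QuotSMulTop y B) :=
      flat_quotSMulTop_of_isSMulRegular fun I => isSMulRegular_tensor_of_closedFibre h.1 _
    exact ⟨isSMulRegular_tensor_of_closedFibre h.1 L,
      ((quotSMulTopTensorEquiv y B L).isWeaklyRegular_congr ys).1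
        (ih (((quotSMulTopTensorEquiv y B _).isWeaklyRegular_congr ys).2 h.2))⟩

/-- Flatness embeds the closed fibre in `B ⊗ L`, where regularity restricts; flatness of `B/yB`
keeps this embedding at the next step. -/
theorem isWeaklyRegular_closedFibre_of_tensor {R A B : Type u} [CommRing R] [CommRing A]
    [Algebra R A] [AddCommGroup B] [Module R B] [Module A B] [IsScalarTower R A B]
    [IsNoetherianRing R] [IsLocalRing R] [IsNoetherianRing A] [IsLocalRing A]
    [IsLocalHom (algebraMap R A)] [Module.Finite A B] [Module.Flat R B] {ys : List A}
    {L : Type u} [AddCommGroup L] [Module R L] {f : (R ⧸ maximalIdeal R) →ₗ[R] L}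
    (hf : Function.Injective f) (h : IsWeaklyRegular (B ⊗[R] L) ys) :
    IsWeaklyRegular (B ⊗[R] (R ⧸ maximalIdeal R)) ys := by
  induction ys generalizing B with
  | nil => simp
  | cons y ys ih =>
    rw [isWeaklyRegular_cons_iff] at h ⊢
    have hy : IsSMulRegular (B ⊗[R] (R ⧸ maximalIdeal R)) y :=
      h.1.of_injective (TensorProduct.AlgebraTensorModule.lTensor A B f)
        (Module.Flat.lTensor_preserves_injective_linearMap f hf)
    have hflat : Module.Flat R (QuotSMulTop y B) :=
      flat_quotSMulTop_of_isSMulRegular fun I => isSMulRegular_tensor_of_closedFibre hy _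
    exact ⟨hy, ((quotSMulTopTensorEquiv y B _).isWeaklyRegular_congr ys).1
        (ih (((quotSMulTopTensorEquiv y B L).isWeaklyRegular_congr ys).2 h.2))⟩

end FlatRegular

/-! ### Supports under flat base change. -/

section BaseChangeSupport

variable {R A : Type*} [CommRing R] [CommRing A] [Algebra R A] {M : Type*} [AddCommGroup M]
  [Module R M]

/-- For the converse, a prime in the support of `M` contains the annihilator `I` of some `m`.
Flatness turns `R/I ⊆ M` into `A/IA ⊆ A ⊗ M`. -/
theorem mem_support_tensorProduct_iff [Module.Flat R A] [Module.Finite R M]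
    {q : PrimeSpectrum A} :
    q ∈ Module.support A (A ⊗[R] M) ↔
      PrimeSpectrum.comap (algebraMap R A) q ∈ Module.support R M := by
  constructor
  · intro hq
    rw [mem_support_iff_of_finite]
    intro r hr
    refine annihilator_le_of_mem_support hq (?_ : algebraMap R A r ∈ _)
    rw [mem_annihilator] at hr ⊢
    intro t
    induction t with
    | zero => simp
    | tmul a m => rw [algebraMap_smul, ← TensorProduct.tmul_smul, hr, TensorProduct.tmul_zero]
    | add a b ha hb => rw [smul_add, ha, hb, add_zero]
  · intro hq
    obtain ⟨m, hm⟩ := mem_support_iff_exists_annihilator.1 hq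
    set I := (Submodule.span R {m}).annihilator with hI
    have hI' : I = LinearMap.ker (LinearMap.toSpanSingleton R M m) := by
      ext r
      simp [hI]
    let f : (R ⧸ I) →ₗ[R] M := I.liftQ (LinearMap.toSpanSingleton R M m) hI'.le
    have hf : Function.Injective f := by
      rw [← LinearMap.ker_eq_bot]
      exact Submodule.ker_liftQ_eq_bot _ _ _ hI'.ge
    refine support_subset_of_injective (TensorProduct.AlgebraTensorModule.lTensor A A f)
      (Module.Flat.lTensor_preserves_injective_linearMap f hf) ?_
    rw [(Algebra.TensorProduct.quotIdealMapEquivTensorQuot A I).symm.toLinearEquiv.support_eq,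
      mem_support_iff_of_finite, Ideal.annihilator_quotient]
    exact Ideal.map_le_iff_le_comap.2 hm

theorem supportDim_tensor_quotient (I : Ideal R) :
    supportDim A (A ⊗[R] (R ⧸ I)) = ringKrullDim (A ⧸ I.map (algebraMap R A)) := by
  rw [← supportDim_quotient_eq_ringKrullDim]
  exact supportDim_eq_of_equiv
    (Algebra.TensorProduct.quotIdealMapEquivTensorQuot A I).symm.toLinearEquiv

theorem mem_support_closedFibre_iff [IsLocalRing R] [Module.Flat R A] {q : PrimeSpectrum A} :
    q ∈ Module.support A (A ⊗[R] (R ⧸ maximalIdeal R)) ↔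
      PrimeSpectrum.comap (algebraMap R A) q = closedPoint R := by
  rw [mem_support_tensorProduct_iff, mem_support_iff_of_finite, Ideal.annihilator_quotient,
    PrimeSpectrum.ext_iff]
  exact ⟨fun h => (le_maximalIdeal (PrimeSpectrum.comap _ q).2.ne_top).antisymm h, fun h => h.ge⟩

theorem nontrivial_tensor_of_isLocalHom [IsLocalRing R] [IsLocalRing A]
    [IsLocalHom (algebraMap R A)] [Module.Flat R A] [Module.Finite R M] [Nontrivial M] :
    Nontrivial (A ⊗[R] M) := by
  refine nonempty_support_iff.1 ⟨closedPoint A, mem_support_tensorProduct_iff.2 ?_⟩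
  rw [comap_closedPoint]
  exact closedPoint_mem_support R M

theorem height_add_ringKrullDim_quotient_le_supportDim (p : Module.support R M) :
    (Order.height p : WithBot ℕ∞) + ringKrullDim (R ⧸ p.1.asIdeal) ≤ supportDim R M := by
  have : Nonempty (Module.support R M) := ⟨p⟩
  rw [supportDim, Order.krullDim_eq_iSup_height_add_coheight_of_nonempty,
    ringKrullDim_quotient_eq_coheight, ← coheight_support_eq]
  exact_mod_cast le_iSup (fun a : Module.support R M => Order.height a + Order.coheight a) p

theorem supportDim_eq_height_closedPoint [IsLocalRing R]
    (h : closedPoint R ∈ Module.support R M) :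
    supportDim R M = Order.height (⟨closedPoint R, h⟩ : Module.support R M) := by
  let _ : OrderTop (Module.support R M) :=
    { top := ⟨closedPoint R, h⟩
      le_top := fun p => le_maximalIdeal p.1.2.ne_top }
  exact Order.height_top_eq_krullDim.symm

/-- Going down lifts a chain below the contraction of `q` to a chain below `q`, one prime at a time
from the top. -/
theorem le_height_support_tensor [Module.Flat R A] [Module.Finite R M] (k : ℕ)
    (q : PrimeSpectrum A)
    (hp : PrimeSpectrum.comap (algebraMap R A) q ∈ Module.support R M)
    (hk : (k : ℕ∞) ≤ Order.height (⟨_, hp⟩ : Module.support R M)) :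
    (k : ℕ∞) ≤ Order.height
      (⟨q, mem_support_tensorProduct_iff.2 hp⟩ : Module.support A (A ⊗[R] M)) := by
  induction k generalizing q with
  | zero => simp
  | succ k ih =>
    obtain ⟨l, hl, hlen⟩ := Order.exists_series_of_le_height _ hk
    have hlt : l.eraseLast.last < l.last := l.eraseLast_last_rel_last (by omega)
    have hk' : (k : ℕ∞) ≤ Order.height l.eraseLast.last := by
      have := Order.length_le_height_last (p := l.eraseLast)
      rwa [RelSeries.eraseLast_length, hlen, Nat.add_sub_cancel] at this
    generalize l.eraseLast.last = p₁ at hlt hk'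
    rw [hl] at hlt
    have : q.asIdeal.LiesOver (PrimeSpectrum.comap (algebraMap R A) q).asIdeal := ⟨rfl⟩
    obtain ⟨q₁, hq₁, hq₁p, hover⟩ := Ideal.exists_ideal_lt_liesOver_of_lt (p := p₁.1.asIdeal)
      (q := (PrimeSpectrum.comap (algebraMap R A) q).asIdeal) q.asIdeal hlt
    have hp₁ : p₁.1 = PrimeSpectrum.comap (algebraMap R A) ⟨q₁, hq₁p⟩ :=
      PrimeSpectrum.ext hover.over
    obtain ⟨p₁, hp₁s⟩ := p₁
    obtain rfl := hp₁
    have h := ih ⟨q₁, hq₁p⟩ hp₁s hk'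
    push_cast
    refine (add_le_add_left h 1).trans (Order.height_add_one_le ?_)
    exact hq₁

end BaseChangeSupport

/-! ### Dimension and the Cohen–Macaulay property along flat local maps. -/

section FlatLocal

variable {R A : Type*} [CommRing R] [CommRing A] [IsNoetherianRing R] [IsLocalRing R]
  [IsNoetherianRing A] [IsLocalRing A] [Algebra R A] [IsLocalHom (algebraMap R A)]
  [Module.Flat R A] {M : Type*} [AddCommGroup M] [Module R M] [Module.Finite R M]

variable (A M) in
/-- The dimension formula for a flat local homomorphism. -/
theorem supportDim_tensor_eq_add :
    supportDim A (A ⊗[R] M) =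
      supportDim R M + supportDim A (A ⊗[R] (R ⧸ maximalIdeal R)) := by
  rcases subsingleton_or_nontrivial M with hM | hM
  · simp [supportDim_eq_bot_of_subsingleton]
  have hnt : Nontrivial (A ⊗[R] (R ⧸ maximalIdeal R)) := nontrivial_tensor_of_isLocalHom
  refine le_antisymm ?_ ?_
  -- Modulo the images of a system of parameters of `M`, the support of `A ⊗ M` lies in that of the
  -- closed fibre.
  · obtain ⟨xs, hxs, hlen, hdim⟩ := exists_parameters (R := R) (M := M)
    have h := supportDim_le_supportDim_quotient_ofList_add_length (M := A ⊗[R] M)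
      (xs.map (algebraMap R A)) (by
        simp only [List.mem_map, forall_exists_index, and_imp, forall_apply_eq_imp_iff₂]
        exact fun x hx => map_nonunit (algebraMap R A) x (hxs x hx))
    rw [List.length_map, hlen, add_comm] at h
    refine h.trans (add_le_add_right (supportDim_mono_of_support_subset fun q hq => ?_) _)
    rw [support_quotient_ofList] at hq
    rw [mem_support_closedFibre_iff, PrimeSpectrum.ext_iff]
    refine supportDim_le_zero_iff.1 hdim.le _ ?_
    rw [support_quotient_ofList]
    exact ⟨mem_support_tensorProduct_iff.1 hq.1,
      fun x hx => hq.2 _ (List.mem_map_of_mem hx)⟩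
  · obtain ⟨n, hn⟩ := exists_supportDim_eq_natCast R M
    obtain ⟨m, hm⟩ := exists_supportDim_eq_natCast A (A ⊗[R] (R ⧸ maximalIdeal R))
    -- This `q` realizes the dimension of the closed fibre. It lies over the maximal ideal, so a
    -- chain of length `n` in the support of `M` lifts below it.
    obtain ⟨q, hq, hqm⟩ : ∃ q ∈ Module.support A (A ⊗[R] (R ⧸ maximalIdeal R)),
        (m : WithBot ℕ∞) ≤ ringKrullDim (A ⧸ q.asIdeal) := by
      by_contra! hcon
      obtain ⟨q₀, hq₀⟩ := (nonempty_support_iff (R := A)).2 hnt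
      obtain ⟨k, rfl⟩ : ∃ k, m = k + 1 := by
        obtain ⟨k, hk⟩ := exists_ringKrullDim_quotient_eq_natCast q₀
        have := hcon q₀ hq₀
        rw [hk] at this
        have : k < m := by exact_mod_cast this
        exact ⟨m - 1, by omega⟩
      have : supportDim A (A ⊗[R] (R ⧸ maximalIdeal R)) ≤ k := supportDim_le_iff.2 fun q hq => by
        obtain ⟨j, hj⟩ := exists_ringKrullDim_quotient_eq_natCast q
        have h := hcon q hq
        rw [hj] at h ⊢
        have : j < k + 1 := by exact_mod_cast h
        exact_mod_cast Nat.lt_succ_iff.1 this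
      rw [hm] at this
      have : k + 1 ≤ k := by exact_mod_cast this
      omega
    have hqc := mem_support_closedFibre_iff.1 hq
    have hs : PrimeSpectrum.comap (algebraMap R A) q ∈ Module.support R M :=
      hqc ▸ closedPoint_mem_support R M
    have hheight : (n : ℕ∞) ≤ Order.height (⟨_, hs⟩ : Module.support R M) := by
      have h := supportDim_eq_height_closedPoint (closedPoint_mem_support R M)
      rw [hn] at h
      simp only [hqc]
      exact_mod_cast h.le
    have h := le_height_support_tensor n q hs hheight
    rw [hn, hm]
    refine le_trans ?_ (height_add_ringKrullDim_quotient_le_supportDim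
      ⟨q, mem_support_tensorProduct_iff.2 hs⟩)
    exact add_le_add (by exact_mod_cast h) hqm

/-- For a flat local homomorphism `R → A` with closed fibre `F`, the module `A ⊗ M` is
Cohen–Macaulay if `M` and `F` are. -/
theorem IsCohenMacaulayModule.tensor {R A M : Type u} [CommRing R] [CommRing A]
    [IsNoetherianRing R] [IsLocalRing R] [IsNoetherianRing A] [IsLocalRing A] [Algebra R A]
    [IsLocalHom (algebraMap R A)] [Module.Flat R A] [AddCommGroup M] [Module R M]
    [Module.Finite R M] (hM : IsCohenMacaulayModule R M)
    (hF : IsCohenMacaulayModule A (A ⊗[R] (R ⧸ maximalIdeal R))) :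
    IsCohenMacaulayModule A (A ⊗[R] M) := by
  obtain ⟨rs, hrs, hreg, hlen⟩ := hM
  induction rs generalizing M with
  | nil =>
    obtain ⟨ys, hys, hysreg, hyslen⟩ := hF
    refine ⟨ys, hys, isWeaklyRegular_tensor_of_closedFibre hysreg M, ?_⟩
    rw [supportDim_tensor_eq_add, hlen, hyslen]
    simp
  | cons x rs ih =>
    rw [isWeaklyRegular_cons_iff] at hreg
    have hx := hrs x (by simp)
    have hx' : algebraMap R A x ∈ maximalIdeal A := map_nonunit (algebraMap R A) x hx
    refine .of_quotSMulTop hx' ((isSMulRegular_algebraMap_iff A).2 (hreg.1.lTensor A))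
      ((isCohenMacaulayModule_congr (QuotSMulTop.algebraMapTensorEquivTensorQuotSMulTop x M A)).2
        (ih (fun r hr => hrs r (by simp [hr])) hreg.2 ?_))
    rw [← supportDim_quotSMulTop_succ_eq_supportDim hreg.1 hx, List.length_cons, Nat.cast_add,
      Nat.cast_one] at hlen
    exact ENat.WithBot.add_one_cancel.1 hlen

/-- If `dim M = 0`, then `A ⊗ M` and the closed fibre have the same support, so parameters of the
fibre are regular on `A ⊗ M`, and on the fibre inside it. Otherwise a parameter of `M` stays one on
`A ⊗ M` by the dimension formula; it is regular there, hence on `M` by faithful flatness. -/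
theorem IsCohenMacaulayModule.of_tensor {R A M : Type u} [CommRing R] [CommRing A]
    [IsNoetherianRing R] [IsLocalRing R] [IsNoetherianRing A] [IsLocalRing A] [Algebra R A]
    [IsLocalHom (algebraMap R A)] [Module.Flat R A] [AddCommGroup M] [Module R M]
    [Module.Finite R M] (h : IsCohenMacaulayModule A (A ⊗[R] M)) :
    IsCohenMacaulayModule R M ∧ IsCohenMacaulayModule A (A ⊗[R] (R ⧸ maximalIdeal R)) := by
  have hff : Module.FaithfullyFlat R A := .of_flat_of_isLocalHom
  have hnt : Nontrivial M := by
    by_contra hM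
    rw [not_nontrivial_iff_subsingleton] at hM
    have := h.nontrivial
    exact not_subsingleton (A ⊗[R] M) inferInstance
  obtain ⟨n, hn⟩ := exists_supportDim_eq_natCast R M
  induction n generalizing M with
  | zero =>
    refine ⟨⟨[], by simp, by simp, by simpa using hn⟩, ?_⟩
    have hnt : Nontrivial (A ⊗[R] (R ⧸ maximalIdeal R)) := nontrivial_tensor_of_isLocalHom
    obtain ⟨f, hf⟩ := exists_injective_residue_of_supportDim_eq_zero (R := R) (by simpa using hn)
    obtain ⟨ys, hys, hlen, hdim⟩ :=
      exists_parameters (R := A) (M := A ⊗[R] (R ⧸ maximalIdeal R))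
    refine ⟨ys, hys, isWeaklyRegular_closedFibre_of_tensor hf (h.isWeaklyRegular ys hys ?_),
      hlen.symm⟩
    have hsupp : Module.support A (A ⊗[R] M) =
        Module.support A (A ⊗[R] (R ⧸ maximalIdeal R)) := by
      ext q
      rw [mem_support_closedFibre_iff, mem_support_tensorProduct_iff,
        support_of_supportDim_eq_zero (R := R) (N := M) (by simpa using hn),
        PrimeSpectrum.zeroLocus_eq_singleton]
      rfl
    rw [supportDim_congr_of_support_eq hsupp, ← hlen, supportDim_congr_of_support_eq
      (N := (A ⊗[R] (R ⧸ maximalIdeal R)) ⧸ (Ideal.ofList ys • ⊤ :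
        Submodule A (A ⊗[R] (R ⧸ maximalIdeal R)))), hdim, zero_add]
    rw [support_quotient_ofList, support_quotient_ofList, hsupp]
  | succ n ih =>
    obtain ⟨x, hx, hxn⟩ := exists_parameter hn
    have hx' : algebraMap R A x ∈ maximalIdeal A := map_nonunit (algebraMap R A) x hx
    have e := QuotSMulTop.algebraMapTensorEquivTensorQuotSMulTop x M A
    obtain ⟨hreg, hCM⟩ := h.isSMulRegular_of_parameter hx' (by
      rw [supportDim_eq_of_equiv e, supportDim_tensor_eq_add, supportDim_tensor_eq_add A M, hn,
        hxn, add_right_comm]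
      simp)
    rw [isCohenMacaulayModule_congr e] at hCM
    obtain ⟨h1, h2⟩ := ih hCM (nontrivial_quotSMulTop_of_mem_maximalIdeal M hx) hxn
    refine ⟨.of_quotSMulTop hx ?_ h1, h2⟩
    exact ((isSMulRegular_algebraMap_iff A).1 hreg).of_injective (TensorProduct.mk R A M 1)
      (Module.FaithfullyFlat.tensorProduct_mk_injective M)

end FlatLocal

/-! ### Localization at a prime. -/

section Localization

variable {A : Type*} [CommRing A] (q : PrimeSpectrum A) {N : Type*} [AddCommGroup N] [Module A N]

theorem comap_closedPoint_localization :
    PrimeSpectrum.comap (algebraMap A (Localization.AtPrime q.asIdeal))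
      (closedPoint (Localization.AtPrime q.asIdeal)) = q :=
  PrimeSpectrum.ext Localization.AtPrime.under_maximalIdeal

/-- Chains in the support of `N_q` contract to chains below `q` in the support of `N`, and these
continue above `q`. -/
theorem supportDim_localization_add_le [Module.Finite A N] (hq : q ∈ Module.support A N) :
    supportDim (Localization.AtPrime q.asIdeal) (Localization.AtPrime q.asIdeal ⊗[A] N) +
      ringKrullDim (A ⧸ q.asIdeal) ≤ supportDim A N := by
  have hc : closedPoint (Localization.AtPrime q.asIdeal) ∈ Module.support
      (Localization.AtPrime q.asIdeal) (Localization.AtPrime q.asIdeal ⊗[A] N) := by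
    rw [mem_support_tensorProduct_iff, comap_closedPoint_localization]
    exact hq
  rw [supportDim_eq_height_closedPoint hc]
  refine le_trans (add_le_add_left ?_ _) (height_add_ringKrullDim_quotient_le_supportDim ⟨q, hq⟩)
  let φ : Module.support (Localization.AtPrime q.asIdeal)
      (Localization.AtPrime q.asIdeal ⊗[A] N) → Module.support A N :=
    fun p => ⟨_, mem_support_tensorProduct_iff.1 p.2⟩
  have hφ : StrictMono φ := by
    have hinj := PrimeSpectrum.localization_comap_injective (Localization.AtPrime q.asIdeal)
      q.asIdeal.primeCompl
    intro a b hab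
    refine lt_of_le_of_ne (Ideal.comap_mono (K := a.1.asIdeal) (L := b.1.asIdeal) hab.le) ?_
    intro h
    exact hab.ne (Subtype.ext (hinj (congrArg Subtype.val h)))
  have h := Order.height_le_height_apply_of_strictMono φ hφ ⟨_, hc⟩
  have hφc : φ ⟨_, hc⟩ = ⟨q, hq⟩ := Subtype.ext (comap_closedPoint_localization q)
  rw [hφc] at h
  exact_mod_cast h

theorem isSMulRegular_localization_iff {x : A} :
    IsSMulRegular (Localization.AtPrime q.asIdeal ⊗[A] N) x ↔
      ∀ n : N, x • n = 0 → ∃ s ∉ q.asIdeal, s • n = 0 := by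
  let f : N →ₗ[A] Localization.AtPrime q.asIdeal ⊗[A] N := TensorProduct.mk A _ N 1
  have hf : IsLocalizedModule q.asIdeal.primeCompl f := inferInstance
  refine (isSMulRegular_iff_right_eq_zero_of_smul (R := A)
    (M := Localization.AtPrime q.asIdeal ⊗[A] N)).trans ?_
  constructor
  · intro h n hn
    have h1 := h (f n) (by rw [← map_smul, hn, map_zero])
    obtain ⟨s, hs⟩ := (IsLocalizedModule.eq_zero_iff q.asIdeal.primeCompl f).1 h1
    exact ⟨s, s.2, hs⟩
  · intro h t ht
    obtain ⟨⟨n, s⟩, hns⟩ := IsLocalizedModule.surj q.asIdeal.primeCompl f t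
    have hxn : f (x • n) = 0 := by
      rw [map_smul, ← hns, smul_comm, ht, smul_zero]
    obtain ⟨s', hs'⟩ := (IsLocalizedModule.eq_zero_iff q.asIdeal.primeCompl f).1 hxn
    obtain ⟨r, hr, hrn⟩ := h (s' • n) (by rw [smul_comm, hs'])
    have hfn : f n = 0 := by
      refine (IsLocalizedModule.eq_zero_iff q.asIdeal.primeCompl f).2 ⟨⟨r, hr⟩ * s', ?_⟩
      rw [mul_smul]
      exact hrn
    rw [hfn] at hns
    exact IsLocalizedModule.smul_injective f s (hns.trans (smul_zero s).symm)

/-- Tensor products commute with the formation of `N/IN`. -/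
noncomputable def tensorQuotSMulTopEquiv (B N : Type*) [AddCommGroup B] [Module A B]
    [AddCommGroup N] [Module A N] (I : Ideal A) :
    ((B ⊗[A] N) ⧸ (I • ⊤ : Submodule A (B ⊗[A] N))) ≃ₗ[A]
      B ⊗[A] (N ⧸ (I • ⊤ : Submodule A N)) :=
  (TensorProduct.quotTensorEquivQuotSMul (B ⊗[A] N) I).symm ≪≫ₗ
    TensorProduct.leftComm A _ _ _ ≪≫ₗ
    (TensorProduct.quotTensorEquivQuotSMul N I).lTensor B

theorem isWeaklyRegular_localization_iff (xs : List A) :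
    IsWeaklyRegular (Localization.AtPrime q.asIdeal ⊗[A] N) xs ↔
      ∀ (i : ℕ) (h : i < xs.length) (n : N), xs[i] • n ∈ Ideal.ofList (xs.take i) •
        (⊤ : Submodule A N) → ∃ s ∉ q.asIdeal, s • n ∈ Ideal.ofList (xs.take i) •
        (⊤ : Submodule A N) := by
  rw [isWeaklyRegular_iff]
  refine forall₂_congr fun i h => ?_
  rw [(tensorQuotSMulTopEquiv _ N _).isSMulRegular_congr, isSMulRegular_localization_iff,
    (Submodule.mkQ_surjective _).forall]
  simp only [Submodule.mkQ_apply, ← Submodule.Quotient.mk_smul, Submodule.Quotient.mk_eq_zero]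

theorem supportDim_tensor_quotient_ofList (B : Type*) [CommRing B] [Algebra A B] [Module.Flat A B]
    [Module.Finite A N] (xs : List A) :
    supportDim B ((B ⊗[A] N) ⧸
        (Ideal.ofList (xs.map (algebraMap A B)) • ⊤ : Submodule B (B ⊗[A] N))) =
      supportDim B (B ⊗[A] (N ⧸ (Ideal.ofList xs • ⊤ : Submodule A N))) := by
  apply supportDim_congr_of_support_eq
  ext p
  rw [support_quotient_ofList, mem_support_tensorProduct_iff, support_quotient_ofList]
  simp [mem_support_tensorProduct_iff]

end Localization

/-! ### Serre classes, supports and the local criterion. -/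

section SerreClass

variable {A : Type u} [CommRing A]

/-- A class of modules is determined by supports if a finitely generated module belongs to it
exactly when all `A/p` with `p` in its support do. -/
def IsSupportDetermined (S : ObjectProperty (ModuleCat.{u} A)) : Prop :=
  ∀ (X : Type u) [AddCommGroup X] [Module A X] [Module.Finite A X],
    S (ModuleCat.of A X) ↔ ∀ p ∈ Module.support A X, S (ModuleCat.of A (A ⧸ p.asIdeal))

section

variable (S : ObjectProperty (ModuleCat.{u} A)) [S.IsSerreClass]
  {X Y Z : Type u} [AddCommGroup X] [Module A X] [AddCommGroup Y] [Module A Y] [AddCommGroup Z]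
  [Module A Z]

theorem prop_of_injective {f : X →ₗ[A] Y} (hf : Function.Injective f)
    (h : S (ModuleCat.of A Y)) : S (ModuleCat.of A X) :=
  have : Mono (ModuleCat.ofHom f) := (ModuleCat.mono_iff_injective _).2 hf
  S.prop_of_mono (ModuleCat.ofHom f) h

theorem prop_of_surjective {f : X →ₗ[A] Y} (hf : Function.Surjective f)
    (h : S (ModuleCat.of A X)) : S (ModuleCat.of A Y) :=
  have : Epi (ModuleCat.ofHom f) := (ModuleCat.epi_iff_surjective _).2 hf
  S.prop_of_epi (ModuleCat.ofHom f) h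

theorem prop_of_exact {f : X →ₗ[A] Y} {g : Y →ₗ[A] Z} (hf : Function.Injective f)
    (hg : Function.Surjective g) (hfg : Function.Exact f g) (hX : S (ModuleCat.of A X))
    (hZ : S (ModuleCat.of A Z)) : S (ModuleCat.of A Y) := by
  have hmono : Mono (ModuleCat.ofHom f) := (ModuleCat.mono_iff_injective _).2 hf
  have hepi : Epi (ModuleCat.ofHom g) := (ModuleCat.epi_iff_surjective _).2 hg
  let C : ShortComplex (ModuleCat.{u} A) := ShortComplex.mk (ModuleCat.ofHom f)
    (ModuleCat.ofHom g) (by rw [← ModuleCat.ofHom_comp, hfg.linearMap_comp_eq_zero]; rfl)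
  have hC : C.ShortExact :=
    { exact := (ShortComplex.ShortExact.moduleCat_exact_iff_function_exact C).2 hfg
      mono_f := hmono
      epi_g := hepi }
  exact S.prop_X₂_of_shortExact hC hX hZ

/-- A prime `p` in the support contains the annihilator of some `x`, so `A/p` is a quotient of a
cyclic submodule. Conversely, `X` has a filtration by quotients `A/p` with `p` in its support. -/
theorem isSupportDetermined_of_isSerreClass [IsNoetherianRing A] : IsSupportDetermined S := by
  intro X _ _ _
  constructor
  · intro hX p hp
    obtain ⟨x, hx⟩ := mem_support_iff_exists_annihilator.1 hp
    have h1 : S (ModuleCat.of A (Submodule.span A {x})) :=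
      prop_of_injective S (Submodule.injective_subtype _) hX
    have h2 : S (ModuleCat.of A (A ⧸ LinearMap.ker (LinearMap.toSpanSingleton A X x))) := by
      refine prop_of_injective S (f := (LinearMap.ker (LinearMap.toSpanSingleton A X x)).liftQ
        (LinearMap.toSpanSingleton A X x) le_rfl) ?_ hX
      rw [← LinearMap.ker_eq_bot]
      exact Submodule.ker_liftQ_eq_bot _ _ _ le_rfl
    have hle : LinearMap.ker (LinearMap.toSpanSingleton A X x) ≤ p.asIdeal := by
      refine le_trans ?_ hx
      intro a ha
      simpa [Submodule.mem_annihilator_span_singleton] using ha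
    exact prop_of_surjective S (f := Submodule.factor hle) (Submodule.factor_surjective hle) h2
  · intro h
    induction ‹Module.Finite A X› using
      IsNoetherianRing.induction_on_isQuotientEquivQuotientPrime A with
    | subsingleton N => exact S.prop_of_isZero (ModuleCat.isZero_of_subsingleton _)
    | quotient N p e =>
      exact prop_of_injective S e.injective (h p (by
        rw [e.support_eq, mem_support_iff_of_finite, Ideal.annihilator_quotient]))
    | exact N₁ N₂ N₃ f g hf hg hfg ih₁ ih₃ =>
      rw [support_of_exact hfg hf hg] at h
      exact prop_of_exact S hf hg hfg (ih₁ fun p hp => h p (Or.inl hp))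
        (ih₃ fun p hp => h p (Or.inr hp))

end

variable {S : ObjectProperty (ModuleCat.{u} A)} {N : Type u} [AddCommGroup N] [Module A N]

/-- The primes in the support of `A ⊗ X` are exactly those in the supports of the `A/pA` with `p` in
the support of `X`. -/
theorem IsSupportDetermined.contractedClass {R : Type u} [CommRing R] [Algebra R A]
    [Module.Flat R A] (hS : IsSupportDetermined S) : IsSupportDetermined (contractedClass R S) := by
  intro X _ _ _
  refine (hS (A ⊗[R] X)).trans ⟨fun h p hp => (hS (A ⊗[R] (R ⧸ p.asIdeal))).2 fun q hq => ?_,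
    fun h q hq => ?_⟩
  · rw [mem_support_tensorProduct_iff, mem_support_iff_of_finite, Ideal.annihilator_quotient] at hq
    exact h q (mem_support_tensorProduct_iff.2 (mem_support_mono hq hp))
  · refine (hS (A ⊗[R] (R ⧸ _))).1 (h _ (mem_support_tensorProduct_iff.1 hq)) q ?_
    rw [mem_support_tensorProduct_iff, mem_support_iff_of_finite, Ideal.annihilator_quotient]

variable [IsNoetherianRing A] [Module.Finite A N]

/-- The `i`-th colon quotient vanishes at `q` exactly when `xᵢ` is regular on `N_q` modulo its
predecessors. -/
theorem isWeakSequence_iff (hS : IsSupportDetermined S) (xs : List A) :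
    IsWeakSequence S N xs ↔ ∀ q ∈ serreSupport S N,
      IsWeaklyRegular (Localization.AtPrime q.asIdeal ⊗[A] N) xs := by
  have key (i : ℕ) (hi : i < xs.length) (q : PrimeSpectrum A) :
      q ∉ Module.support A (colonElem (listSMulTop (xs.take i) N) xs[i] ⧸
        (listSMulTop (xs.take i) N).submoduleOf (colonElem (listSMulTop (xs.take i) N) xs[i])) ↔
      ∀ (n : N), xs[i] • n ∈ Ideal.ofList (xs.take i) •
        (⊤ : Submodule A N) → ∃ s ∉ q.asIdeal, s • n ∈ Ideal.ofList (xs.take i) •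
        (⊤ : Submodule A N) := by
    rw [notMem_support_iff', (Submodule.mkQ_surjective _).forall, Subtype.forall]
    refine forall₂_congr fun n hn => ?_
    simp only [Submodule.mkQ_apply, ← Submodule.Quotient.mk_smul, Submodule.Quotient.mk_eq_zero]
    rfl
  simp only [isWeaklyRegular_localization_iff, IsWeakSequence]
  constructor
  · intro h q hq i hi
    rw [← key]
    intro hqi
    exact hq.2 ((hS _).1 (h i hi) q hqi)
  · intro h i hi
    rw [hS]
    intro q hq
    by_contra hqS
    refine (key i hi q).2 ?_ hq
    by_cases hqN : q ∈ Module.support A N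
    · exact h q ⟨hqN, hqS⟩ i hi
    · intro n _
      obtain ⟨s, hs, hsn⟩ := notMem_support_iff'.1 hqN n
      exact ⟨s, hs, by rw [hsn]; exact zero_mem _⟩

variable [IsLocalRing A]

/-- The local characterization of `S`-Cohen–Macaulay modules. -/
theorem isSerreCohenMacaulay_iff (hS : IsSupportDetermined S) :
    IsSerreCohenMacaulay S N ↔ ∀ q ∈ serreSupport S N,
      IsCohenMacaulayModule (Localization.AtPrime q.asIdeal)
        (Localization.AtPrime q.asIdeal ⊗[A] N) ∧
      supportDim (Localization.AtPrime q.asIdeal) (Localization.AtPrime q.asIdeal ⊗[A] N) +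
        ringKrullDim (A ⧸ q.asIdeal) = supportDim A N := by
  constructor
  · intro h q hq
    obtain ⟨xs, hxq, hlen, hdim⟩ := exists_partial_parameters hq.1
    have hxm : ∀ x ∈ xs, x ∈ maximalIdeal A := fun x hx =>
      le_maximalIdeal q.2.ne_top (hxq x hx)
    have hqx : q ∈ Module.support A (N ⧸ (Ideal.ofList xs • ⊤ : Submodule A N)) := by
      rw [support_quotient_ofList]; exact ⟨hq.1, hxq⟩
    have hnt : Nontrivial (N ⧸ (Ideal.ofList xs • ⊤ : Submodule A N)) :=
      nonempty_support_iff.1 ⟨q, hqx⟩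
    obtain ⟨ys, hym, hylen, hydim⟩ :=
      exists_parameters (R := A) (M := N ⧸ (Ideal.ofList xs • ⊤ : Submodule A N))
    have hsop : IsSystemOfParameters N (xs ++ ys) := by
      refine ⟨?_, ?_, ?_⟩
      · simp only [List.mem_append]
        rintro x (hx | hx)
        exacts [hxm x hx, hym x hx]
      · rw [List.length_append, ← hlen, ← hdim, ← hylen, add_comm]
        push_cast
        rfl
      · rw [isFiniteLength_iff_supportDim_le_zero, supportDim_quotient_ofList_append, hydim]
    have hreg := ((isWeaklyRegular_append_iff _ _ _).1
      ((isWeakSequence_iff hS _).1 (h _ hsop) q hq)).1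
    rw [← isWeaklyRegular_map_algebraMap_iff (S := Localization.AtPrime q.asIdeal)] at hreg
    have hxm' : ∀ x ∈ xs.map (algebraMap A (Localization.AtPrime q.asIdeal)),
        x ∈ maximalIdeal (Localization.AtPrime q.asIdeal) := by
      intro x hx
      obtain ⟨z, hz, rfl⟩ := List.mem_map.1 hx
      exact (IsLocalization.AtPrime.to_map_mem_maximal_iff _ q.asIdeal z).2 (hxq z hz)
    have hntq : Nontrivial (Localization.AtPrime q.asIdeal ⊗[A] N) := by
      refine (nonempty_support_iff (R := Localization.AtPrime q.asIdeal)).1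
        ⟨closedPoint _, ?_⟩
      rw [mem_support_tensorProduct_iff, comap_closedPoint_localization]
      exact hq.1
    have hreg' := IsRegular.of_isWeaklyRegular_of_mem_maximalIdeal _ hxm' hreg
    have hd := supportDim_add_length_eq_supportDim_of_isRegular _ hreg'
    -- Since `xs` already cuts `N` down to dimension `dim A/q`, this forces `dim N_q/(xs)N_q = 0`;
    -- the length of `xs` is then `dim N_q`.
    have hle := supportDim_localization_add_le q hqx
    obtain ⟨k, hk⟩ := exists_ringKrullDim_quotient_eq_natCast q
    rw [hdim, hk, ← supportDim_tensor_quotient_ofList] at hle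
    have hntx := hreg'.quot_ofList_smul_nontrivial ⊤
    obtain ⟨j, hj⟩ := exists_supportDim_eq_natCast (Localization.AtPrime q.asIdeal)
      ((Localization.AtPrime q.asIdeal ⊗[A] N) ⧸
        (Ideal.ofList (xs.map (algebraMap A (Localization.AtPrime q.asIdeal))) •
          (⊤ : Submodule (Localization.AtPrime q.asIdeal) (Localization.AtPrime q.asIdeal ⊗[A] N))))
    rw [hj] at hle hd
    have hj0 : j = 0 := by
      have : j + k ≤ k := by exact_mod_cast hle
      omega
    rw [hj0, List.length_map, Nat.cast_zero, zero_add] at hd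
    refine ⟨⟨_, hxm', hreg, by rw [← hd, List.length_map]⟩, ?_⟩
    rw [← hd, ← hlen, add_comm]
  · intro h xs hxs
    rw [isWeakSequence_iff hS]
    intro q hq
    obtain ⟨hCM, hdim⟩ := h q hq
    rw [isWeaklyRegular_localization_iff]
    intro i hi n hn
    -- The initial segment includes `xs[i]` itself. If it lies in `q`, a dimension count makes it
    -- part of a system of parameters of `N_q`; otherwise a member outside `q` is the required `s`.
    by_cases hxq : ∀ x ∈ xs.take (i + 1), x ∈ q.asIdeal
    · have hqx : q ∈ Module.support A
          (N ⧸ (Ideal.ofList (xs.take (i + 1)) • ⊤ : Submodule A N)) := by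
        rw [support_quotient_ofList]; exact ⟨hq.1, hxq⟩
      have hle := supportDim_localization_add_le q hqx
      have hle' := supportDim_le_supportDim_quotient_ofList_add_length
        (M := N ⧸ (Ideal.ofList (xs.take (i + 1)) • ⊤ : Submodule A N)) (xs.drop (i + 1))
        fun x hx => hxs.mem_maximalIdeal x (List.mem_of_mem_drop hx)
      rw [← supportDim_quotient_ofList_append, List.take_append_drop] at hle'
      have hfin := isFiniteLength_iff_supportDim_le_zero.1 hxs.finiteLength
      obtain ⟨k, hk⟩ := exists_ringKrullDim_quotient_eq_natCast q
      have hreg := hCM.isWeaklyRegular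
        ((xs.take (i + 1)).map (algebraMap A (Localization.AtPrime q.asIdeal))) (by
          intro x hx
          obtain ⟨z, hz, rfl⟩ := List.mem_map.1 hx
          exact (IsLocalization.AtPrime.to_map_mem_maximal_iff _ q.asIdeal z).2 (hxq z hz)) (by
          rw [supportDim_tensor_quotient_ofList]
          -- Adding `k = dim A/q` to both sides allows the global equality `hdim` to replace `dim
          -- N_q`.
          refine (ENat.WithBot.add_le_add_natCast_right_iff (c := k)).1 ?_
          rw [← hk, hdim, ← hxs.length_eq, add_right_comm]
          refine (add_le_add_left (hle.trans (hle'.trans (add_le_add_left hfin _))) _).trans ?_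
          rw [zero_add, List.length_map, List.length_drop, List.length_take]
          norm_cast
          omega)
      rw [isWeaklyRegular_map_algebraMap_iff, isWeaklyRegular_localization_iff] at hreg
      have hti : (xs.take (i + 1)).take i = xs.take i := by simp [List.take_take]
      have h1 := hreg i (by simp; omega) n
      rw [hti] at h1
      exact h1 (by simpa using hn)
    · push Not at hxq
      obtain ⟨x, hx, hxq⟩ := hxq
      refine ⟨x, hxq, ?_⟩
      rw [List.take_succ_eq_append_getElem hi, List.mem_append, List.mem_singleton] at hx
      rcases hx with hx | rfl
      · exact Submodule.smul_mem_smul (Ideal.subset_span hx) trivial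
      · exact hn

end SerreClass

/-! ### Comparison of the ring and module notions. -/

section CohenMacaulayRing

/-- Regular sequences have length at most the finite dimension `n`, so a supremum equal to `n` is
attained. -/
theorem isCohenMacaulayLocalRing_iff (B : Type u) [CommRing B] [IsLocalRing B]
    [IsNoetherianRing B] : IsCohenMacaulayLocalRing B ↔ IsCohenMacaulayModule B B := by
  have hbound (rs : List B) (h : IsRegular B rs) :
      (rs.length : WithBot ℕ∞) ≤ ringKrullDim B := by
    have h1 := supportDim_add_length_eq_supportDim_of_isRegular rs h
    have hnt := h.quot_ofList_smul_nontrivial ⊤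
    obtain ⟨j, hj⟩ := exists_supportDim_eq_natCast B
      (B ⧸ (Ideal.ofList rs • ⊤ : Submodule B B))
    rw [hj, supportDim_self_eq_ringKrullDim] at h1
    rw [← h1]
    exact_mod_cast Nat.le_add_left _ _
  obtain ⟨n, hn⟩ := exists_supportDim_eq_natCast B B
  rw [IsCohenMacaulayLocalRing, IsCohenMacaulayModule, hn]
  rw [supportDim_self_eq_ringKrullDim] at hn
  rw [hn] at hbound ⊢
  constructor
  · intro h
    by_contra! hcon
    have hlt : localDepth B + 1 ≤ n := by
      -- The truncated `n - 1` is harmless: for `n = 0` the empty sequence already attains the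
      -- dimension.
      refine (add_le_add_left (iSup₂_le (a := ((n - 1 : ℕ) : ℕ∞)) fun rs hrs => ?_) 1).trans ?_
      · have h1 := hcon rs hrs.1 hrs.2.toIsWeaklyRegular
        have h2 : rs.length ≤ n := by exact_mod_cast hbound rs hrs.2
        have h3 : n ≠ rs.length := fun h => h1 (by rw [h])
        exact_mod_cast (by omega : rs.length ≤ n - 1)
      · have h0 : n ≠ 0 := fun h => hcon [] (by simp) (by simp) (by simp [h])
        exact_mod_cast (by omega : n - 1 + 1 ≤ n)
    have h' : localDepth B = n := by exact_mod_cast h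
    rw [h'] at hlt
    have : n + 1 ≤ n := by exact_mod_cast hlt
    omega
  · rintro ⟨rs, hrs, hreg, hlen⟩
    have hlen' : n = rs.length := by exact_mod_cast hlen
    have hreg' := IsRegular.of_isWeaklyRegular_of_mem_maximalIdeal B hrs hreg
    have : localDepth B = n := by
      refine le_antisymm (iSup₂_le fun rs hrs => ?_) ?_
      · exact_mod_cast hbound rs hrs.2
      · rw [hlen']
        exact le_iSup₂_of_le rs ⟨hrs, hreg'⟩ le_rfl
    rw [this]
    rfl

theorem isCohenMacaulayModule_quotient_iff {Q : Type*} [CommRing Q] [IsLocalRing Q] (J : Ideal Q)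
    [IsLocalRing (Q ⧸ J)] :
    IsCohenMacaulayModule (Q ⧸ J) (Q ⧸ J) ↔ IsCohenMacaulayModule Q (Q ⧸ J) := by
  have hmem (x : Q) : Ideal.Quotient.mk J x ∈ maximalIdeal (Q ⧸ J) ↔ x ∈ maximalIdeal Q := by
    have : IsLocalHom (Ideal.Quotient.mk J) :=
      IsLocalHom.of_surjective (Ideal.Quotient.mk J) Ideal.Quotient.mk_surjective
    simp
  have hdim : supportDim (Q ⧸ J) (Q ⧸ J) = supportDim Q (Q ⧸ J) := by
    rw [supportDim_self_eq_ringKrullDim, supportDim_quotient_eq_ringKrullDim]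
  rw [IsCohenMacaulayModule, IsCohenMacaulayModule, hdim,
    (List.map_surjective_iff.2 (Ideal.Quotient.mk_surjective (I := J))).exists]
  refine exists_congr fun rs => ?_
  rw [List.length_map, List.forall_mem_map, ← Ideal.Quotient.algebraMap_eq,
    isWeaklyRegular_map_algebraMap_iff, Ideal.Quotient.algebraMap_eq]
  simp only [hmem]

theorem height_map_maximalIdeal_quotient {Q : Type*} [CommRing Q] [IsLocalRing Q] (J : Ideal Q)
    [IsLocalRing (Q ⧸ J)] :
    (((maximalIdeal Q).map (Ideal.Quotient.mk J)).height : WithBot ℕ∞) = ringKrullDim (Q ⧸ J) := by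
  have hJ : J ≠ ⊤ := Ideal.Quotient.nontrivial_iff.1 inferInstance
  have : ((maximalIdeal Q).map (Ideal.Quotient.mk J)).IsMaximal :=
    .map_of_surjective_of_ker_le Ideal.Quotient.mk_surjective (by
      rw [Ideal.mk_ker]; exact le_maximalIdeal hJ)
  rw [eq_maximalIdeal this, maximalIdeal_height_eq_ringKrullDim]

end CohenMacaulayRing

/-! ### The local map `R_p → A_q` and its closed fibre. -/

section Fibres

variable {R A : Type u} [CommRing R] [CommRing A] [Algebra R A] (q : PrimeSpectrum A)
  (M : Type u) [AddCommGroup M] [Module R M]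

local notation "Rp" =>
  Localization.AtPrime (PrimeSpectrum.asIdeal (PrimeSpectrum.comap (algebraMap R A) q))
local notation "Aq" => Localization.AtPrime (PrimeSpectrum.asIdeal q)

instance liesOver_comap :
    q.asIdeal.LiesOver (PrimeSpectrum.comap (algebraMap R A) q).asIdeal := ⟨rfl⟩

attribute [local instance] Localization.AtPrime.algebraOfLiesOver

instance isLocalHom_localization : IsLocalHom (algebraMap Rp Aq) :=
  inferInstanceAs (IsLocalHom (Localization.localRingHom _ _ _ _))

/-- Localization of a base change as a base change along `R_p → A_q`. -/
noncomputable def localizationTensorEquiv :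
    Aq ⊗[A] (A ⊗[R] M) ≃ₗ[Aq] Aq ⊗[Rp] (Rp ⊗[R] M) :=
  AlgebraTensorModule.cancelBaseChange R A Aq Aq M ≪≫ₗ
    (AlgebraTensorModule.cancelBaseChange R Rp Aq Aq M).symm

theorem map_maximalIdeal_localization :
    (maximalIdeal Rp).map (algebraMap Rp Aq) =
      (contractExtend R q.asIdeal).map (algebraMap A Aq) := by
  rw [← Localization.AtPrime.map_eq_maximalIdeal, Ideal.map_map, contractExtend, Ideal.map_map,
    ← IsScalarTower.algebraMap_eq, ← IsScalarTower.algebraMap_eq]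
  rfl

/-- The closed fibre of `R_p → A_q`. -/
noncomputable def closedFibreEquiv :
    Aq ⊗[Rp] (Rp ⧸ maximalIdeal Rp) ≃ₗ[Aq] FibreAt R q.asIdeal :=
  (Algebra.TensorProduct.quotIdealMapEquivTensorQuot Aq (maximalIdeal Rp)).symm.toLinearEquiv ≪≫ₗ
    Submodule.quotEquivOfEq _ _ (map_maximalIdeal_localization q)

variable [IsNoetherianRing R] [IsNoetherianRing A] [Module.Flat R A]

/-- The height formula for going down, applied to `R → A` and to `R_p → A_q`, gives two expressions
for `ht q`; the finite `ht p` cancels. -/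
theorem ringKrullDim_fibreAt :
    ringKrullDim (FibreAt R q.asIdeal) =
      (q.asIdeal.map (Ideal.Quotient.mk (contractExtend R q.asIdeal))).height := by
  have h1 := Ideal.height_eq_height_add_of_liesOver_of_hasGoingDown
    (PrimeSpectrum.comap (algebraMap R A) q).asIdeal q.asIdeal
  have h2 := Ideal.height_eq_height_add_of_liesOver_of_hasGoingDown (maximalIdeal Rp)
    (maximalIdeal Aq)
  rw [map_maximalIdeal_localization] at h2
  have h3 : (maximalIdeal Rp).height =
      (PrimeSpectrum.comap (algebraMap R A) q).asIdeal.height := by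
    have := (maximalIdeal_height_eq_ringKrullDim (R := Rp)).trans
      (IsLocalization.AtPrime.ringKrullDim_eq_height
        (PrimeSpectrum.comap (algebraMap R A) q).asIdeal Rp)
    exact_mod_cast this
  have h4 : (maximalIdeal Aq).height = q.asIdeal.height := by
    have := (maximalIdeal_height_eq_ringKrullDim (R := Aq)).trans
      (IsLocalization.AtPrime.ringKrullDim_eq_height q.asIdeal Aq)
    exact_mod_cast this
  rw [h3, h4, h1] at h2
  have h5 := WithTop.add_left_cancel (Ideal.height_ne_top_of_isPrime
    (I := (PrimeSpectrum.comap (algebraMap R A) q).asIdeal)) h2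
  rw [← height_map_maximalIdeal_quotient]
  exact_mod_cast h5.symm

theorem supportDim_localization_tensor [Module.Finite R M] :
    supportDim Aq (Aq ⊗[A] (A ⊗[R] M)) = supportDim Rp (Rp ⊗[R] M) +
      (q.asIdeal.map (Ideal.Quotient.mk (contractExtend R q.asIdeal))).height := by
  rw [supportDim_eq_of_equiv (localizationTensorEquiv q M), supportDim_tensor_eq_add,
    supportDim_eq_of_equiv (closedFibreEquiv q), supportDim_quotient_eq_ringKrullDim,
    ringKrullDim_fibreAt]

theorem isCohenMacaulayModule_localization_tensor_iff [Module.Finite R M] :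
    IsCohenMacaulayModule Aq (Aq ⊗[A] (A ⊗[R] M)) ↔
      IsCohenMacaulayModule Rp (Rp ⊗[R] M) ∧
        IsCohenMacaulayLocalRing (FibreAt R q.asIdeal) := by
  rw [isCohenMacaulayModule_congr (localizationTensorEquiv q M), isCohenMacaulayLocalRing_iff,
    isCohenMacaulayModule_quotient_iff, ← isCohenMacaulayModule_congr (closedFibreEquiv q)]
  exact ⟨fun h => h.of_tensor, fun h => h.1.tensor h.2⟩

/-- This is the localization inequality for `A ⊗ R/p = A/pA`, after dropping the dimension of
`(R/p)_p`. That module must be nonzero, since otherwise its dimension is `⊥`. -/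
theorem height_add_ringKrullDim_quotient_le_fibre :
    ((q.asIdeal.map (Ideal.Quotient.mk (contractExtend R q.asIdeal))).height : WithBot ℕ∞) +
      ringKrullDim (A ⧸ q.asIdeal) ≤ ringKrullDim (A ⧸ contractExtend R q.asIdeal) := by
  have hq : q ∈ Module.support A
      (A ⊗[R] (R ⧸ (PrimeSpectrum.comap (algebraMap R A) q).asIdeal)) := by
    rw [mem_support_tensorProduct_iff, mem_support_iff_of_finite, Ideal.annihilator_quotient]
  have h := supportDim_localization_add_le q hq
  rw [supportDim_localization_tensor, supportDim_tensor_quotient (A := A)] at h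
  refine le_trans (add_le_add_left ?_ _) h
  refine le_add_of_nonneg_left ?_
  have : Nontrivial (Rp ⊗[R] (R ⧸ (PrimeSpectrum.comap (algebraMap R A) q).asIdeal)) := by
    refine (nonempty_support_iff (R := Rp)).1 ⟨closedPoint _, ?_⟩
    rw [mem_support_tensorProduct_iff, comap_closedPoint_localization, mem_support_iff_of_finite,
      Ideal.annihilator_quotient]
  obtain ⟨n, hn⟩ := exists_supportDim_eq_natCast Rp
    (Rp ⊗[R] (R ⧸ (PrimeSpectrum.comap (algebraMap R A) q).asIdeal))
  rw [hn]
  exact_mod_cast Nat.zero_le n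

end Fibres

/-! ### Comparison of Serre supports and of dimension equalities. -/

/-- Going down: every `p` in the `S^c`-support of `M` is the contraction of some `q` in the
`S`-support of the base change. -/
theorem exists_mem_serreSupport_comap_eq {R A : Type u} [CommRing R] [CommRing A] [Algebra R A]
    [Module.Flat R A] {S : ObjectProperty (ModuleCat.{u} A)} (hS : IsSupportDetermined S)
    {M : Type u} [AddCommGroup M] [Module R M] [Module.Finite R M] {p : PrimeSpectrum R}
    (hp : p ∈ serreSupport (contractedClass R S) M) :
    ∃ q ∈ serreSupport S (A ⊗[R] M), PrimeSpectrum.comap (algebraMap R A) q = p := by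
  have h1 : ¬ S (ModuleCat.of A (A ⊗[R] (R ⧸ p.asIdeal))) := hp.2
  rw [hS] at h1
  push Not at h1
  obtain ⟨q, hq, hqS⟩ := h1
  rw [mem_support_tensorProduct_iff, mem_support_iff_of_finite, Ideal.annihilator_quotient] at hq
  obtain ⟨q₁, hle, hprime, hover₁⟩ := Ideal.exists_ideal_le_liesOver_of_le (p := p.asIdeal)
    (q := (PrimeSpectrum.comap (algebraMap R A) q).asIdeal) q.asIdeal hq
  have hcomap : PrimeSpectrum.comap (algebraMap R A) ⟨q₁, hprime⟩ = p :=
    PrimeSpectrum.ext hover₁.over.symm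
  refine ⟨⟨q₁, hprime⟩, ⟨?_, fun h => hqS ?_⟩, hcomap⟩
  · rw [mem_support_tensorProduct_iff, hcomap]
    exact hp.1
  · refine (hS (A ⧸ q₁)).1 h q ?_
    rw [mem_support_iff_of_finite, Ideal.annihilator_quotient]
    exact hle

theorem comap_mem_serreSupport {R A : Type u} [CommRing R] [CommRing A] [Algebra R A]
    [Module.Flat R A] {S : ObjectProperty (ModuleCat.{u} A)} (hS : IsSupportDetermined S)
    {M : Type u} [AddCommGroup M] [Module R M] [Module.Finite R M] {q : PrimeSpectrum A}
    (hq : q ∈ serreSupport S (A ⊗[R] M)) :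
    PrimeSpectrum.comap (algebraMap R A) q ∈ serreSupport (contractedClass R S) M := by
  refine ⟨mem_support_tensorProduct_iff.1 hq.1, fun h => hq.2 ?_⟩
  refine (hS (A ⊗[R] (R ⧸ (PrimeSpectrum.comap (algebraMap R A) q).asIdeal))).1 h q ?_
  rw [mem_support_tensorProduct_iff, mem_support_iff_of_finite, Ideal.annihilator_quotient]

/-- At a prime `q` over `p`, the dimension equality for `A ⊗ M` at `q` is equivalent to those for
`M` at `p` and for the fibre at `q`. -/
theorem dimension_equality_iff {R A : Type u} [CommRing R] [CommRing A]
    [IsNoetherianRing R] [IsLocalRing R] [IsNoetherianRing A] [IsLocalRing A] [Algebra R A]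
    [IsLocalHom (algebraMap R A)] [Module.Flat R A] (M : Type u) [AddCommGroup M] [Module R M]
    [Module.Finite R M] {q : PrimeSpectrum A} (hq : q ∈ Module.support A (A ⊗[R] M)) :
    supportDim (Localization.AtPrime q.asIdeal) (Localization.AtPrime q.asIdeal ⊗[A] (A ⊗[R] M)) +
        ringKrullDim (A ⧸ q.asIdeal) = supportDim A (A ⊗[R] M) ↔
      (supportDim (Localization.AtPrime (PrimeSpectrum.comap (algebraMap R A) q).asIdeal)
          (Localization.AtPrime (PrimeSpectrum.comap (algebraMap R A) q).asIdeal ⊗[R] M) +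
        ringKrullDim (R ⧸ (PrimeSpectrum.comap (algebraMap R A) q).asIdeal) = supportDim R M) ∧
      ((q.asIdeal.map (Ideal.Quotient.mk (contractExtend R q.asIdeal))).height :
          WithBot ℕ∞) + ringKrullDim (A ⧸ q.asIdeal) =
        ringKrullDim (A ⧸ contractExtend R q.asIdeal) := by
  have hp := mem_support_tensorProduct_iff.1 hq
  have hle := supportDim_localization_add_le _ hp
  have hle' := height_add_ringKrullDim_quotient_le_fibre (R := R) q
  rw [supportDim_localization_tensor, supportDim_tensor_eq_add A M]
  -- The dimension formula for `R/p` introduces the same closed fibre dimension as the one for `M`.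
  have hg : ringKrullDim (A ⧸ contractExtend R q.asIdeal) =
      ringKrullDim (R ⧸ (PrimeSpectrum.comap (algebraMap R A) q).asIdeal) +
        supportDim A (A ⊗[R] (R ⧸ maximalIdeal R)) := by
    rw [← supportDim_quotient_eq_ringKrullDim (PrimeSpectrum.comap (algebraMap R A) q).asIdeal,
      ← supportDim_tensor_eq_add, supportDim_tensor_quotient]
    rfl
  rw [hg] at hle' ⊢
  have hntM : Nontrivial M := nonempty_support_iff.1 ⟨_, hp⟩
  have hntF : Nontrivial (A ⊗[R] (R ⧸ maximalIdeal R)) := nontrivial_tensor_of_isLocalHom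
  have hntp : Nontrivial
      (Localization.AtPrime (PrimeSpectrum.comap (algebraMap R A) q).asIdeal ⊗[R] M) := by
    refine (nonempty_support_iff
      (R := Localization.AtPrime (PrimeSpectrum.comap (algebraMap R A) q).asIdeal)).1
        ⟨closedPoint _, ?_⟩
    rwa [mem_support_tensorProduct_iff, comap_closedPoint_localization]
  obtain ⟨a, ha⟩ := exists_supportDim_eq_natCast
    (Localization.AtPrime (PrimeSpectrum.comap (algebraMap R A) q).asIdeal)
    (Localization.AtPrime (PrimeSpectrum.comap (algebraMap R A) q).asIdeal ⊗[R] M)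
  obtain ⟨b, hb⟩ := exists_supportDim_eq_natCast (FibreAt R q.asIdeal) (FibreAt R q.asIdeal)
  rw [supportDim_self_eq_ringKrullDim, ringKrullDim_fibreAt] at hb
  obtain ⟨c, hc⟩ := exists_ringKrullDim_quotient_eq_natCast q
  obtain ⟨d, hd⟩ := exists_ringKrullDim_quotient_eq_natCast
    (PrimeSpectrum.comap (algebraMap R A) q)
  obtain ⟨e, he⟩ := exists_supportDim_eq_natCast R M
  obtain ⟨f, hf⟩ := exists_supportDim_eq_natCast A (A ⊗[R] (R ⧸ maximalIdeal R))
  rw [ha, hd, he] at hle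
  rw [hb, hc, hd, hf] at hle'
  rw [ha, hb, hc, hd, he, hf]
  -- In natural numbers: given `a + d ≤ e` and `b + c ≤ d + f`, the equality `a + b + c = e + f`
  -- forces equality in both.
  norm_cast at hle hle' ⊢
  omega

end SerreCM

theorem theorem3p9 (R A : Type u) [CommRing R] [CommRing A]
    [IsNoetherianRing R] [IsLocalRing R] [IsNoetherianRing A] [IsLocalRing A]
    [Algebra R A] [IsLocalHom (algebraMap R A)] [Module.Flat R A]
    (S : ObjectProperty (ModuleCat.{u} A)) [S.IsSerreClass]
    (M : Type u) [AddCommGroup M] [Module R M] [Module.Finite R M] :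
    SerreCM.IsSerreCohenMacaulay S (A ⊗[R] M) ↔
      SerreCM.IsSerreCohenMacaulay (SerreCM.contractedClass R S) M ∧
      (∀ q ∈ SerreCM.serreSupport S (A ⊗[R] M),
        SerreCM.IsCohenMacaulayLocalRing (SerreCM.FibreAt R q.asIdeal)) ∧
      (∀ q ∈ SerreCM.serreSupport S (A ⊗[R] M),
        ((q.asIdeal.map (Ideal.Quotient.mk (SerreCM.contractExtend R q.asIdeal))).height :
            WithBot ℕ∞) + ringKrullDim (A ⧸ q.asIdeal) =
          ringKrullDim (A ⧸ SerreCM.contractExtend R q.asIdeal)) := by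
  have hS := SerreCM.isSupportDetermined_of_isSerreClass S
  rw [SerreCM.isSerreCohenMacaulay_iff hS,
    SerreCM.isSerreCohenMacaulay_iff (hS.contractedClass (R := R))]
  constructor
  · intro h
    refine ⟨fun p hp => ?_, fun q hq => ?_, fun q hq => ?_⟩
    -- The condition on `M` concerns primes of `R`, so each one needs a `q` above it in the
    -- `S`-support.
    · obtain ⟨q, hq, rfl⟩ := SerreCM.exists_mem_serreSupport_comap_eq hS hp
      obtain ⟨h1, h2⟩ := h q hq
      exact ⟨((SerreCM.isCohenMacaulayModule_localization_tensor_iff q M).1 h1).1,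
        ((SerreCM.dimension_equality_iff M hq.1).1 h2).1⟩
    · exact ((SerreCM.isCohenMacaulayModule_localization_tensor_iff q M).1 (h q hq).1).2
    · exact ((SerreCM.dimension_equality_iff M hq.1).1 (h q hq).2).2
  · rintro ⟨h1, h2, h3⟩ q hq
    obtain ⟨h4, h5⟩ := h1 _ (SerreCM.comap_mem_serreSupport hS hq)
    exact ⟨(SerreCM.isCohenMacaulayModule_localization_tensor_iff q M).2 ⟨h4, h2 q hq⟩,
      (SerreCM.dimension_equality_iff M hq.1).2 ⟨h5, h3 q hq⟩⟩
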